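/- Consider an asynchronous message-passing system of $n$ processes on a complete communication graph with reliable channels (each message between correct processes is eventually delivered, with unbounded delay, and the receiver of a message knows who sent it). A set of at most $f$ processes is Byzantine: these deviate arbitrarily from the algorithm and collude. The system is authenticated: each process can sign messages, everybody can verify who signed a message, and no process can create a signature of another one; in particular Byzantine processes cannot forge signatures of correct processes, but they may use every signature that a correct process has issued before. The other (correct) processes run a deterministic event-driven algorithm. In the Byzantine lattice agreement problem each process $i$ has an input $x_i$ in a join semilattice $(X,\le,\sqcup)$. Let $C$ be the set of correct processes and $t \le f$ the number of Byzantine processes. Each correct process $i$ has to decide, eventually and irrevocably, an output $y_i\in X$ such that: - Comparability: for all $i,j\in C$, $y_i\le y_j$ or $y_j\le y_i$. - Downward-Validity: $x_i\le y_i$ for all $i\in C$. - Upward-Validity: there is a set $B\subseteq X$ with $|B|\le t$ and $\bigsqcup\{y_i : i\in C\}\le\bigsqcup(\{x_i : i\in C\}\cup B)$. Theorem. There is an absolute constant $c$ such that, for all $n$ and $f$ with $f<n/3$ and every join semilattice $X$, there is an algorithm that solves the Byzantine lattice agreement problem with inputs in $X$ in every execution of the authenticated asynchronous system with $n$ processes,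 at most $f$ of which are Byzantine. It takes $O(\log f)$ asynchronous rounds: if local computation takes no time and each message between correct processes takes at most one unit of time, every correct process has decided by time $c\,(1+\log_2 f)$. It takes $O(n^2\log f)$ messages: in each execution the correct processes send at most $c\,n^2(1+\log_2 f)$ messages in total. (For $f\le 1$ read $\log_2 f$ as $0$.) -/

import Mathlib

/-! # Asynchronous message passing with Byzantine failures and digital signatures

The system has `n` processes, with ids in `Fin n`, on a complete communication graph.
Signatures are idealised: a signed message is a term that names its signer, so everybody can
verify who signed it, and the only restriction is on who can create such a term. -/

namespace AuthBLA

universe u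

/-- Messages over a type `D` of plain data: plain data, pairs, and `sign i m`, which is the
message `m` together with the signature of process `i` on it. Signatures can be nested. -/
inductive Msg (n : ℕ) (D : Type u) : Type u
  | data (d : D) : Msg n D
  | pair (a b : Msg n D) : Msg n D
  | sign (i : Fin n) (m : Msg n D) : Msg n D

/-- All the signatures that occur in a message: `(i, p) ∈ m.sigs` means that `m` contains the
signature of `i` on `p`. -/
def Msg.sigs {n : ℕ} {D : Type u} : Msg n D → Set (Fin n × Msg n D)
  | .data _ => ∅
  | .pair a b => a.sigs ∪ b.sigs
  | .sign i m => insert (i, m) m.sigs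

/-- A deterministic, event-driven algorithm for `n` processes whose inputs and outputs are
in `X`. Process `i` with input `x` starts in the state `(start i x).1` and sends the messages
`(start i x).2`, a list of pairs (destination, message). When process `i` in state `s` receives
`m` from process `j`, it moves to the state `(step i s j m).1` and sends the messages
`(step i s j m).2`. `output s` is the value decided in state `s`, if there is one. -/
structure Protocol (n : ℕ) (X : Type u) where
  /-- local states -/
  State : Type u
  /-- plain data in messages -/
  Data : Type u
  /-- initial state and initial messages -/
  start : Fin n → X → State × List (Fin n × Msg n Data)
  /-- reaction to a message from a given sender -/
  step : Fin n → State → Fin n → Msg n Data → State × List (Fin n × Msg n Data)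
  /-- decided value -/
  output : State → Option X

namespace Protocol

variable {n : ℕ} {X : Type u}

/-- The state of process `i` with input `x` after receiving, in this order, the messages in
`h` (pairs of sender and message). -/
def localState (P : Protocol n X) (i : Fin n) (x : X) (h : List (Fin n × Msg n P.Data)) :
    P.State :=
  h.foldl (fun s e => (P.step i s e.1 e.2).1) (P.start i x).1

/-- A process running the protocol can create its own signatures only: each signature of
another process in a message that it sends occurs in a message that it has received. -/
structure SignsHonestly (P : Protocol n X) : Prop where
  start : ∀ (i : Fin n) (x : X), ∀ o ∈ (P.start i x).2, ∀ s ∈ o.2.sigs, s.1 = i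
  step : ∀ (i : Fin n) (x : X) (h : List (Fin n × Msg n P.Data)) (j : Fin n)
    (m : Msg n P.Data), ∀ o ∈ (P.step i (P.localState i x h) j m).2, ∀ s ∈ o.2.sigs,
    s.1 = i ∨ s ∈ m.sigs ∨ ∃ e ∈ h, s ∈ e.2.sigs

end Protocol

/-- A message with its sender and its destination. -/
structure Envelope (n : ℕ) (D : Type u) where
  src : Fin n
  dst : Fin n
  msg : Msg n D

/-- A global configuration: the local states, the list of all messages sent so far by correct
processes (a message is identified by its position in this list), and the set of those that
have been delivered. The local states of Byzantine processes are never used. -/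
structure Config {n : ℕ} {X : Type u} (P : Protocol n X) where
  state : Fin n → P.State
  sent : List (Envelope n P.Data)
  delivered : Set ℕ

section Executions

variable {n : ℕ} {X : Type u}

/-- Put the sender on a list of outgoing messages. -/
def envelopes {D : Type u} (i : Fin n) (l : List (Fin n × Msg n D)) : List (Envelope n D) :=
  l.map fun o => ⟨i, o.1, o.2⟩

/-- The initial configuration when the Byzantine processes are those in `F` and the inputs
are `x`: each correct process has sent its initial messages. -/
def Config.initial (P : Protocol n X) (F : Finset (Fin n)) (x : Fin n → X) : Config P where
  state i := (P.start i (x i)).1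
  sent := ((List.finRange n).filter (fun i => i ∉ F)).flatMap
    fun i => envelopes i (P.start i (x i)).2
  delivered := ∅

/-- Process `i` receives `m` from process `j` and reacts to it. -/
def Config.receive {P : Protocol n X} (c : Config P) (i j : Fin n) (m : Msg n P.Data) :
    Config P where
  state := Function.update c.state i (P.step i (c.state i) j m).1
  sent := c.sent ++ envelopes i (P.step i (c.state i) j m).2
  delivered := c.delivered

/-- The possible events when the Byzantine processes are those in `F`.

* `idle`: nothing happens.
* `deliver`: some message of a correct process that was not delivered before is delivered to
  its destination, a correct process.
* `byzantine`: a correct process `i` receives from a Byzantine process `j` an arbitrary message,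
  subject to unforgeability only: a signature of a correct process in it must have been
  issued by this process before. (No secrecy is assumed: Byzantine processes collude
  and may use all that was ever sent.) -/
inductive Step {P : Protocol n X} (F : Finset (Fin n)) : Config P → Config P → Prop
  | idle (c : Config P) : Step F c c
  | deliver (c : Config P) (id : ℕ) (e : Envelope n P.Data) (sent : c.sent[id]? = some e)
      (pending : id ∉ c.delivered) (correct : e.dst ∉ F) :
      Step F c { c.receive e.dst e.src e.msg with delivered := insert id c.delivered }
  | byzantine (c : Config P) (i j : Fin n) (m : Msg n P.Data) (correct : i ∉ F) (faulty : j ∈ F)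
      (unforgeable : ∀ s ∈ m.sigs, s.1 ∉ F → ∃ e ∈ c.sent, e.src = s.1 ∧ s ∈ e.msg.sigs) :
      Step F c (c.receive i j m)

/-- An execution of `P` with set `F` of Byzantine processes and inputs `x`: an infinite
sequence of configurations. Message delays are unbounded, but channels are reliable: each
message between correct processes is eventually delivered (exactly once, by `Step`). -/
structure Execution (P : Protocol n X) (F : Finset (Fin n)) (x : Fin n → X) where
  conf : ℕ → Config P
  conf_zero : conf 0 = Config.initial P F x
  step : ∀ k, Step F (conf k) (conf (k + 1))
  reliable : ∀ k id e, (conf k).sent[id]? = some e → e.dst ∉ F → ∃ k', id ∈ (conf k').delivered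

namespace Execution

variable {P : Protocol n X} {F : Finset (Fin n)} {x : Fin n → X}

/-- The output of process `i` in the `k`-th configuration. -/
def out (E : Execution P F x) (k : ℕ) (i : Fin n) : Option X :=
  P.output ((E.conf k).state i)

/-- Process `i` outputs `y`, and this is final. -/
structure Decides (E : Execution P F x) (i : Fin n) (y : X) : Prop where
  eventually : ∃ k, E.out k i = some y
  unique : ∀ k z, E.out k i = some z → z = y
  final : ∀ k k', k ≤ k' → E.out k i = some y → E.out k' i = some y

/-- `τ k` is a possible time at which the `k`-th configuration is reached, measured in
asynchronous rounds: the execution starts at time `0`, local computation takes no time, and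
each message between correct processes takes at most one unit of time (while a message sent
by time `τ k` is pending, the next event happens no later than `τ k + 1`). -/
structure IsRoundTiming (E : Execution P F x) (τ : ℕ → ℝ) : Prop where
  zero : τ 0 = 0
  mono : Monotone τ
  delay : ∀ k id e, (E.conf k).sent[id]? = some e → e.dst ∉ F →
    ∀ k', id ∉ (E.conf k').delivered → τ (k' + 1) ≤ τ k + 1

end Execution

end Executions

/-- Byzantine lattice agreement, for the set `F` of Byzantine processes, the inputs `x` and the
outputs `y` (only those of correct processes matter). -/
structure IsBLA {n : ℕ} {X : Type u} [SemilatticeSup X] (F : Finset (Fin n)) (x y : Fin n → X) :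
    Prop where
  comparability : ∀ i ∉ F, ∀ j ∉ F, y i ≤ y j ∨ y j ≤ y i
  downward_validity : ∀ i ∉ F, x i ≤ y i
  upward_validity : ∃ B : Finset X, B.card ≤ F.card ∧ ∃ u v : X,
    IsLUB {a | ∃ i ∉ F, y i = a} u ∧ IsLUB ({a | ∃ i ∉ F, x i = a} ∪ (B : Set X)) v ∧ u ≤ v

/-- `P` is an algorithm for Byzantine lattice agreement in authenticated asynchronous systems
that tolerates `f` Byzantine processes, in at most `T` asynchronous rounds, with at most `M`
messages sent by correct processes in total. -/
structure Solves {n : ℕ} {X : Type u} [SemilatticeSup X] (P : Protocol n X) (f T M : ℕ) :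
    Prop where
  signsHonestly : P.SignsHonestly
  agreement : ∀ (F : Finset (Fin n)), F.card ≤ f → ∀ (x : Fin n → X) (E : Execution P F x),
    ∃ y : Fin n → X, (∀ i ∉ F, E.Decides i (y i)) ∧ IsBLA F x y
  rounds : ∀ (F : Finset (Fin n)), F.card ≤ f → ∀ (x : Fin n → X) (E : Execution P F x)
    (τ : ℕ → ℝ), E.IsRoundTiming τ → ∀ i ∉ F, ∃ k, τ k ≤ T ∧ (E.out k i).isSome
  messages : ∀ (F : Finset (Fin n)), F.card ≤ f → ∀ (x : Fin n → X) (E : Execution P F x) (k : ℕ),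
    (E.conf k).sent.length ≤ M

end AuthBLA

namespace AuthBLA.Halving

universe u

/-! ### Groups of values and what signatures prove about them -/

section GroupSafety

variable {n f : ℕ} {X : Type u}

/-! Inputs are first certified: a process collects `n - f` signatures on its input, and a correct
process certifies at most one input of each process. As `3 * f < n`, two quorums share a correct
process, so every process has at most one certified input, and for a correct process it is the true
one. It then suffices to produce sets of certified inputs that form a chain under inclusion, each
containing the input of its owner. The outputs are the joins of these sets, and the certified inputs
of faulty processes serve as the set `B` of upward validity.

The chain comes from a binary search on cardinality. All values in the group `(ℓ, q)` have at least
`threshold n f ℓ q` elements, and their union has fewer than `threshold n f ℓ q + 2 ^ (depth f -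
ℓ)`. In a group a process writes its value `V` (a quorum signs that it has accepted `V`) and then
reads: a quorum reports what it has accepted, no earlier than the completion of the write. Let `U`
be the union of the reports. If `V` has reached the size `middle`, then `U` goes to the upper child.
If `U` is still smaller than `middle`, then `V` goes to the lower child. In the remaining case `U`
is written in the same group; it has reached `middle`, so its own read leads to the upper child.

Everything rests on one fact, `Run.exists_mem_of_completion_le`: if writes are ordered by the first
moment at which a quorum has accepted them, the read after a later write sees every earlier one. So
the low value that is completed last has read all low values, and its result is smaller than
`middle`: this bounds the lower child. A low value is contained in every result sent to the upper
child, as otherwise its own read would have contained a value of size `middle`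
(`Run.low_subset_high`). Thus each level halves the width of the groups and keeps different groups
nested (`Run.levelInvariant`). On the last level the width is 1, so a group holds at most one value,
and the values form a chain (`Run.comparable`).

Faulty processes are held to these rules because `Valid` is a proof tree of signatures that anybody
can check. Messages carry all that their sender knows, so the receiver of a request can check it at
once.

For the cost, `slot` numbers the queries. The slots of a correct process increase up to `O(log f)`,
and each process answers at most one query per asker and slot; this bounds the messages
(`length_sent_le`). A slot takes at most two units of time (`reach`). -/

/-- Sets of proposed inputs, each with the process that proposed it. -/
abbrev Value (n : ℕ) (X : Type u) : Type u := Finset (Fin n × X)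

/-- What a process may ask the others for. `write ℓ q V` and `read ℓ q V` concern the group with
index `q` on level `ℓ`. -/
inductive Query (n : ℕ) (X : Type u) : Type u
  | certify
  | publish
  | write (ℓ q : ℕ) (V : Value n X)
  | read (ℓ q : ℕ) (V : Value n X)

/-- Plain data in messages: the facts that processes sign, and requests. `saw ℓ q V S` states that,
after a quorum had accepted `V` in the group `(ℓ, q)`, the signer had accepted the values in `S`
there. -/
inductive Datum (n : ℕ) (X : Type u) : Type u
  | input (x : X)
  | certified (j : Fin n) (x : X)
  | wrote (ℓ q : ℕ) (V : Value n X)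
  | saw (ℓ q : ℕ) (V : Value n X) (S : Finset (Value n X))
  | request (r : Query n X)

/-- Sets of signatures. -/
abbrev Sigs (n : ℕ) (X : Type u) : Type u := Set (Fin n × Msg n (Datum n X))

/-- At least `n - f` processes have signed `d`. -/
def Quorum (f : ℕ) (K : Sigs n X) (d : Datum n X) : Prop :=
  ∃ Q : Finset (Fin n), n - f ≤ Q.card ∧ ∀ s ∈ Q, (s, Msg.data d) ∈ K

/-- The number of levels. -/
def depth (f : ℕ) : ℕ := Nat.log 2 f + 1

/-- Values in the group `(ℓ, q)` have at least this size. -/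
def threshold (n f ℓ q : ℕ) : ℕ := n - f + q * 2 ^ (depth f - ℓ)

/-- The size at which the group `(ℓ, q)` is split. -/
def middle (n f ℓ q : ℕ) : ℕ := threshold n f (ℓ + 1) (2 * q + 1)

open Classical in
/-- The union of all values reported by the processes in `Q`. -/
noncomputable def gather (Q : Finset (Fin n)) (S : Fin n → Finset (Value n X)) : Value n X :=
  Q.biUnion fun s => (S s).biUnion id

/-- A quorum `Q` has answered the query `read ℓ q V` with the reports `S`. -/
structure Answers (f : ℕ) (K : Sigs n X) (ℓ q : ℕ) (V : Value n X) (Q : Finset (Fin n))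
    (S : Fin n → Finset (Value n X)) : Prop where
  card : n - f ≤ Q.card
  mem : ∀ s ∈ Q, (s, Msg.data (.saw ℓ q V (S s))) ∈ K

/-- The signatures in `K` prove that `V` may be written in the group `(ℓ, q)`. -/
inductive Valid (f : ℕ) (K : Sigs n X) : ℕ → ℕ → Value n X → Prop
  | init (V : Value n X) (cert : ∀ e ∈ V, Quorum f K (.certified e.1 e.2))
      (card : n - f ≤ V.card) : Valid f K 0 0 V
  | join (ℓ q : ℕ) (V : Value n X) (Q : Finset (Fin n)) (S : Fin n → Finset (Value n X))
      (ans : Answers f K ℓ q V Q S) (val : ∀ s ∈ Q, ∀ W ∈ S s, Valid f K ℓ q W) :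
      Valid f K ℓ q (gather Q S)
  | low (ℓ q : ℕ) (V : Value n X) (Q : Finset (Fin n)) (S : Fin n → Finset (Value n X))
      (ans : Answers f K ℓ q V Q S) (val : ∀ s ∈ Q, ∀ W ∈ S s, Valid f K ℓ q W)
      (lt : ℓ < depth f) (card : (gather Q S).card < middle n f ℓ q) :
      Valid f K (ℓ + 1) (2 * q) V
  | high (ℓ q : ℕ) (V : Value n X) (Q : Finset (Fin n)) (S : Fin n → Finset (Value n X))
      (ans : Answers f K ℓ q V Q S) (val : ∀ s ∈ Q, ∀ W ∈ S s, Valid f K ℓ q W)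
      (lt : ℓ < depth f) (card : middle n f ℓ q ≤ V.card) :
      Valid f K (ℓ + 1) (2 * q + 1) (gather Q S)

/-- The signatures in `K` prove that `U` is a result of the query `read ℓ q V`. -/
def Reads (f : ℕ) (K : Sigs n X) (ℓ q : ℕ) (V U : Value n X) : Prop :=
  ∃ Q S, Answers f K ℓ q V Q S ∧ (∀ s ∈ Q, ∀ W ∈ S s, Valid f K ℓ q W) ∧ gather Q S = U

/-! ### Monotonicity in the set of signatures, and arithmetic of the thresholds -/

theorem mem_gather {Q : Finset (Fin n)} {S : Fin n → Finset (Value n X)} {e : Fin n × X} :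
    e ∈ gather Q S ↔ ∃ s ∈ Q, ∃ W ∈ S s, e ∈ W := by
  simp [gather]

theorem subset_gather {Q : Finset (Fin n)} {S : Fin n → Finset (Value n X)} {s : Fin n}
    {W : Value n X} (hs : s ∈ Q) (hW : W ∈ S s) : W ⊆ gather Q S :=
  fun _ he => mem_gather.2 ⟨s, hs, W, hW, he⟩

theorem Quorum.mono {K K' : Sigs n X} (h : K ⊆ K') {d : Datum n X} :
    Quorum f K d → Quorum f K' d :=
  fun ⟨Q, hQ, hs⟩ => ⟨Q, hQ, fun s hs' => h (hs s hs')⟩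

theorem Answers.mono {K K' : Sigs n X} (h : K ⊆ K') {ℓ q : ℕ} {V : Value n X}
    {Q : Finset (Fin n)} {S : Fin n → Finset (Value n X)} (a : Answers f K ℓ q V Q S) :
    Answers f K' ℓ q V Q S :=
  ⟨a.card, fun s hs => h (a.mem s hs)⟩

theorem Valid.mono {K K' : Sigs n X} (h : K ⊆ K') {ℓ q : ℕ} {V : Value n X}
    (v : Valid f K ℓ q V) : Valid f K' ℓ q V := by
  induction v with
  | init V cert card => exact .init V (fun e he => (cert e he).mono h) card
  | join ℓ q V Q S ans _ ih => exact .join ℓ q V Q S (ans.mono h) ih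
  | low ℓ q V Q S ans _ lt card ih => exact .low ℓ q V Q S (ans.mono h) ih lt card
  | high ℓ q V Q S ans _ lt card ih => exact .high ℓ q V Q S (ans.mono h) ih lt card

theorem Reads.mono {K K' : Sigs n X} (h : K ⊆ K') {ℓ q : ℕ} {V U : Value n X} :
    Reads f K ℓ q V U → Reads f K' ℓ q V U :=
  fun ⟨Q, S, a, v, e⟩ => ⟨Q, S, a.mono h, fun s hs W hW => (v s hs W hW).mono h, e⟩

theorem threshold_two_mul {ℓ : ℕ} (h : ℓ < depth f) (q : ℕ) :
    threshold n f (ℓ + 1) (2 * q) = threshold n f ℓ q := by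
  unfold threshold
  obtain ⟨r, hr⟩ : ∃ r, depth f - ℓ = r + 1 := ⟨depth f - ℓ - 1, by omega⟩
  rw [hr, show depth f - (ℓ + 1) = r by omega, pow_succ]
  ring

theorem middle_eq (ℓ q : ℕ) :
    middle n f ℓ q = threshold n f (ℓ + 1) (2 * q) + 2 ^ (depth f - (ℓ + 1)) := by
  unfold middle threshold
  ring

theorem two_pow_depth_sub {ℓ : ℕ} (h : ℓ < depth f) :
    2 ^ (depth f - ℓ) = 2 ^ (depth f - (ℓ + 1)) + 2 ^ (depth f - (ℓ + 1)) := by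
  obtain ⟨r, hr⟩ : ∃ r, depth f - ℓ = r + 1 := ⟨depth f - ℓ - 1, by omega⟩
  rw [hr, show depth f - (ℓ + 1) = r by omega, pow_succ]
  ring

/-! ### Safety from an abstract history of signatures -/

/-- The signatures issued during an execution, as far as safety depends on them: `G k` are those
that exist at time `k`. -/
structure Run (f : ℕ) (F : Finset (Fin n)) (x : Fin n → X) (G : ℕ → Sigs n X) : Prop where
  resilient : 3 * f < n
  faulty_card : F.card ≤ f
  mono : Monotone G
  input_eq : ∀ k, ∀ s ∉ F, ∀ y, (s, Msg.data (.input y)) ∈ G k → y = x s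
  input_mem : ∀ k, ∀ s ∉ F, ∀ j y, (s, Msg.data (.certified j y)) ∈ G k →
    (j, Msg.data (.input y)) ∈ G k
  certified_unique : ∀ k, ∀ s ∉ F, ∀ j y z, (s, Msg.data (.certified j y)) ∈ G k →
    (s, Msg.data (.certified j z)) ∈ G k → y = z
  wrote_valid : ∀ k, ∀ s ∉ F, ∀ ℓ q V, (s, Msg.data (.wrote ℓ q V)) ∈ G k → Valid f (G k) ℓ q V
  saw_after : ∀ k, ∀ s ∉ F, ∀ ℓ q V S, (s, Msg.data (.saw ℓ q V S)) ∈ G k →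
    ∃ k', Quorum f (G k') (.wrote ℓ q V) ∧ ∀ W, (s, Msg.data (.wrote ℓ q W)) ∈ G k' → W ∈ S

/-- All the signatures that ever exist. -/
def total (G : ℕ → Sigs n X) : Sigs n X := {a | ∃ k, a ∈ G k}

theorem subset_total (G : ℕ → Sigs n X) (k : ℕ) : G k ⊆ total G := fun _ h => ⟨k, h⟩

/-- Two quorums share at least `n - 2 * f > f` processes, and at most `f` of these are faulty. -/
theorem exists_correct_of_card {F : Finset (Fin n)} (hf : 3 * f < n) (hF : F.card ≤ f)
    {Q Q' : Finset (Fin n)} (hQ : n - f ≤ Q.card) (hQ' : n - f ≤ Q'.card) :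
    ∃ s ∈ Q, s ∈ Q' ∧ s ∉ F := by
  by_contra! h
  have h1 : (Q ∩ Q').card ≤ F.card := Finset.card_le_card fun s hs =>
    h s (Finset.mem_inter.1 hs).1 (Finset.mem_inter.1 hs).2
  have h2 := Finset.card_union_add_card_inter Q Q'
  have h3 : (Q ∪ Q').card ≤ n := (Finset.card_le_univ _).trans_eq (Fintype.card_fin n)
  omega

/-- The first time at which a quorum has accepted `V` in the group `(ℓ, q)`. -/
noncomputable def completion (f : ℕ) (G : ℕ → Sigs n X) (ℓ q : ℕ) (V : Value n X) : ℕ :=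
  sInf {k | Quorum f (G k) (.wrote ℓ q V)}

/-- The first values in a group, not counting results of reads in the same group. -/
inductive Entry (f : ℕ) (K : Sigs n X) : ℕ → ℕ → Value n X → Prop
  | init (V : Value n X) (cert : ∀ e ∈ V, Quorum f K (.certified e.1 e.2))
      (card : n - f ≤ V.card) : Entry f K 0 0 V
  | low (ℓ q : ℕ) (V U : Value n X) (reads : Reads f K ℓ q V U) (lt : ℓ < depth f)
      (card : U.card < middle n f ℓ q) : Entry f K (ℓ + 1) (2 * q) V
  | high (ℓ q : ℕ) (V U : Value n X) (reads : Reads f K ℓ q V U) (lt : ℓ < depth f)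
      (card : middle n f ℓ q ≤ V.card) : Entry f K (ℓ + 1) (2 * q + 1) U

namespace Run

variable {F : Finset (Fin n)} {x : Fin n → X} {G : ℕ → Sigs n X}

theorem exists_correct (R : Run f F x G) {Q Q' : Finset (Fin n)} (hQ : n - f ≤ Q.card)
    (hQ' : n - f ≤ Q'.card) : ∃ s ∈ Q, s ∈ Q' ∧ s ∉ F :=
  exists_correct_of_card R.resilient R.faulty_card hQ hQ'

/-- Some correct process is among the signers of the answers, and it reports only after it has seen
a quorum for `V`. So even a value read by a faulty process has a completion time. -/
theorem exists_quorum (R : Run f F x G) {ℓ q : ℕ} {V : Value n X} {Q : Finset (Fin n)}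
    {S : Fin n → Finset (Value n X)} (a : Answers f (total G) ℓ q V Q S) :
    ∃ k, Quorum f (G k) (.wrote ℓ q V) := by
  obtain ⟨s, hs, -, hsF⟩ := R.exists_correct a.card a.card
  obtain ⟨k, hk⟩ := a.mem s hs
  obtain ⟨k', h, -⟩ := R.saw_after k s hsF ℓ q V _ hk
  exact ⟨k', h⟩

/-- Reads see all values whose writing was completed earlier. -/
theorem exists_mem_of_completion_le (R : Run f F x G) {ℓ q : ℕ} {V W : Value n X}
    {Q : Finset (Fin n)} {S : Fin n → Finset (Value n X)} (a : Answers f (total G) ℓ q W Q S)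
    {k : ℕ} (hV : Quorum f (G k) (.wrote ℓ q V))
    (h : completion f G ℓ q V ≤ completion f G ℓ q W) : ∃ s ∈ Q, V ∈ S s := by
  have hV' : Quorum f (G (completion f G ℓ q V)) (.wrote ℓ q V) :=
    Nat.sInf_mem (s := {k | Quorum f (G k) (.wrote ℓ q V)}) ⟨k, hV⟩
  obtain ⟨Q', hQ', hs'⟩ := hV'
  obtain ⟨s, hs, hsQ, hsF⟩ := R.exists_correct hQ' a.card
  obtain ⟨k₁, hk₁⟩ := a.mem s hsQ
  obtain ⟨k₂, h₂, h₃⟩ := R.saw_after k₁ s hsF ℓ q W _ hk₁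
  -- When `s` reported, a quorum for `W` existed, so that moment is not before the completion of
  -- `W`, hence not before that of `V`; by then `s` had accepted `V`.
  have hle : completion f G ℓ q W ≤ k₂ := Nat.sInf_le h₂
  exact ⟨s, hsQ, h₃ V (R.mono (h.trans hle) (hs' s hs))⟩

theorem subset_of_completion_le (R : Run f F x G) {ℓ q : ℕ} {V W U : Value n X}
    (r : Reads f (total G) ℓ q W U) {k : ℕ} (hV : Quorum f (G k) (.wrote ℓ q V))
    (h : completion f G ℓ q V ≤ completion f G ℓ q W) : V ⊆ U := by
  obtain ⟨Q, S, a, -, rfl⟩ := r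
  obtain ⟨s, hs, hV⟩ := R.exists_mem_of_completion_le a hV h
  exact subset_gather hs hV

theorem reads_quorum (R : Run f F x G) {ℓ q : ℕ} {V U : Value n X}
    (r : Reads f (total G) ℓ q V U) : ∃ k, Quorum f (G k) (.wrote ℓ q V) := by
  obtain ⟨Q, S, a, -, -⟩ := r
  exact R.exists_quorum a

theorem reads_subset (R : Run f F x G) {ℓ q : ℕ} {V U : Value n X}
    (r : Reads f (total G) ℓ q V U) : V ⊆ U := by
  obtain ⟨k, hk⟩ := R.reads_quorum r
  exact R.subset_of_completion_le r hk le_rfl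

/-- The quorum for `V` contains a correct process, which has checked `V`. This is why the
constructors of `Valid` need not require that the value which was read with is itself valid. -/
theorem reads_valid (R : Run f F x G) {ℓ q : ℕ} {V U : Value n X}
    (r : Reads f (total G) ℓ q V U) : Valid f (total G) ℓ q V := by
  obtain ⟨k, Q, hQ, hs⟩ := R.reads_quorum r
  obtain ⟨s, hsQ, -, hsF⟩ := R.exists_correct hQ hQ
  exact (R.wrote_valid k s hsF ℓ q V (hs s hsQ)).mono (subset_total G k)

/-- A read sees the value that was written just before it. So in the case `join` the value `V` is
among the reports, and the induction hypothesis applies to it. With `subset_of_entries` this reduces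
lower and upper bounds on a group to its entries. -/
theorem exists_entry_subset (R : Run f F x G) {ℓ q : ℕ} {V : Value n X}
    (v : Valid f (total G) ℓ q V) : ∃ V₀, Entry f (total G) ℓ q V₀ ∧ V₀ ⊆ V := by
  induction v with
  | init V cert card => exact ⟨V, .init V cert card, subset_rfl⟩
  | join ℓ q V Q S ans _ ih =>
    obtain ⟨k, hk⟩ := R.exists_quorum ans
    obtain ⟨s, hs, hV⟩ := R.exists_mem_of_completion_le ans hk le_rfl
    obtain ⟨V₀, h₀, hsub⟩ := ih s hs V hV
    exact ⟨V₀, h₀, hsub.trans (subset_gather hs hV)⟩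
  | low ℓ q V Q S ans val lt card _ =>
    exact ⟨V, .low ℓ q V _ ⟨Q, S, ans, val, rfl⟩ lt card, subset_rfl⟩
  | high ℓ q V Q S ans val lt card _ =>
    exact ⟨_, .high ℓ q V _ ⟨Q, S, ans, val, rfl⟩ lt card, subset_rfl⟩

/-- Reads form unions only, so values in a group are unions of entries. -/
theorem subset_of_entries {K : Sigs n X} {ℓ q : ℕ} {V H : Value n X} (v : Valid f K ℓ q V)
    (h : ∀ V₀, Entry f K ℓ q V₀ → V₀ ⊆ H) : V ⊆ H := by
  induction v with
  | init V cert card => exact h V (.init V cert card)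
  | join ℓ q V Q S ans _ ih =>
    intro e he
    obtain ⟨s, hs, W, hW, he⟩ := mem_gather.1 he
    exact ih s hs W hW h he
  | low ℓ q V Q S ans val lt card _ =>
    exact h V (.low ℓ q V _ ⟨Q, S, ans, val, rfl⟩ lt card)
  | high ℓ q V Q S ans val lt card _ =>
    exact h _ (.high ℓ q V _ ⟨Q, S, ans, val, rfl⟩ lt card)

/-! ### Certified inputs -/

theorem eq_of_certified (R : Run f F x G) {j : Fin n} {y z : X}
    (hy : Quorum f (total G) (.certified j y)) (hz : Quorum f (total G) (.certified j z)) :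
    y = z := by
  obtain ⟨Q, hQ, h⟩ := hy
  obtain ⟨Q', hQ', h'⟩ := hz
  obtain ⟨s, hs, hs', hsF⟩ := R.exists_correct hQ hQ'
  obtain ⟨k, hk⟩ := h s hs
  obtain ⟨k', hk'⟩ := h' s hs'
  exact R.certified_unique (max k k') s hsF j y z (R.mono (le_max_left _ _) hk)
    (R.mono (le_max_right _ _) hk')

theorem eq_input_of_certified (R : Run f F x G) {j : Fin n} (hj : j ∉ F) {y : X}
    (hy : Quorum f (total G) (.certified j y)) : y = x j := by
  obtain ⟨Q, hQ, h⟩ := hy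
  obtain ⟨s, hs, -, hsF⟩ := R.exists_correct hQ hQ
  obtain ⟨k, hk⟩ := h s hs
  exact R.input_eq k j hj y (R.input_mem k s hsF j y hk)

/-- All certified inputs. -/
def certifiedSet (f : ℕ) (G : ℕ → Sigs n X) : Set (Fin n × X) :=
  {e | Quorum f (total G) (.certified e.1 e.2)}

theorem injOn_certifiedSet (R : Run f F x G) : Set.InjOn Prod.fst (certifiedSet f G) := by
  rintro ⟨j, y⟩ hy ⟨j', z⟩ hz (rfl : j = j')
  have h : y = z := R.eq_of_certified (j := j) hy hz
  rw [h]

theorem finite_certifiedSet (R : Run f F x G) : (certifiedSet f G).Finite :=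
  Set.Finite.of_finite_image (Set.toFinite _) R.injOn_certifiedSet

theorem valid_certified (R : Run f F x G) {ℓ q : ℕ} {V : Value n X}
    (v : Valid f (total G) ℓ q V) : ∀ e ∈ V, Quorum f (total G) (.certified e.1 e.2) := by
  have key : ∀ {Q : Finset (Fin n)} {S : Fin n → Finset (Value n X)},
      (∀ s ∈ Q, ∀ W ∈ S s, ∀ e ∈ W, Quorum f (total G) (.certified e.1 e.2)) →
      ∀ e ∈ gather Q S, Quorum f (total G) (.certified e.1 e.2) := by
    intro Q S h e he
    obtain ⟨s, hs, W, hW, he⟩ := mem_gather.1 he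
    exact h s hs W hW e he
  induction v with
  | init V cert card => exact cert
  | join ℓ q V Q S ans _ ih => exact key ih
  | low ℓ q V Q S ans val lt card ih =>
    -- The value passed down is `V` and not the union; it is covered because the read saw `V`.
    exact fun e he => key ih e (R.reads_subset ⟨Q, S, ans, val, rfl⟩ he)
  | high ℓ q V Q S ans val lt card ih => exact key ih

/-! ### Halving: the invariant of a level -/

/-- The invariant of the values in the groups of level `ℓ`. -/
structure LevelInvariant (f : ℕ) (K : Sigs n X) (ℓ : ℕ) : Prop where
  le_card : ∀ q V, Valid f K ℓ q V → threshold n f ℓ q ≤ V.card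
  bounded : ∀ q, ∃ H : Value n X, H.card < threshold n f ℓ q + 2 ^ (depth f - ℓ) ∧
    ∀ V, Valid f K ℓ q V → V ⊆ H
  ordered : ∀ q q' V V', q < q' → Valid f K ℓ q V → Valid f K ℓ q' V' → V ⊆ V'

theorem levelInvariant_zero (R : Run f F x G) : LevelInvariant f (total G) 0 where
  le_card q V v := by
    obtain ⟨V₀, h₀, hsub⟩ := R.exists_entry_subset v
    cases h₀ with
    | init _ cert card =>
      exact le_trans (by simpa [threshold] using card) (Finset.card_le_card hsub)
  bounded q := by
    refine ⟨R.finite_certifiedSet.toFinset, ?_, fun V v e he => ?_⟩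
    · have h1 : R.finite_certifiedSet.toFinset.card ≤ n := by
        classical
        rw [← Finset.card_image_of_injOn (f := Prod.fst) (by simpa using R.injOn_certifiedSet)]
        exact (Finset.card_le_univ _).trans_eq (Fintype.card_fin n)
      -- This fixes `depth`: the root group has to be wide enough for all sizes from `n - f` to `n`.
      have h2 : f < 2 ^ (depth f - 0) := Nat.lt_pow_succ_log_self one_lt_two f
      have h3 := R.resilient
      unfold threshold
      omega
    · simpa [certifiedSet] using R.valid_certified v e he
  ordered q q' V V' h v v' := by
    obtain ⟨V₀, h₀, -⟩ := R.exists_entry_subset v'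
    -- On level 0 only the group with index 0 has entries, whereas `q'` is positive.
    cases h₀
    omega

/-- If `V` was completed first, the read of `W` sees `V`. Otherwise the read of `V` sees `W`, and
then `U` has at least `middle` elements, which is excluded. -/
theorem low_subset_high (R : Run f F x G) {ℓ q : ℕ} {V U W T : Value n X}
    (hV : Reads f (total G) ℓ q V U) (hU : U.card < middle n f ℓ q)
    (hW : Reads f (total G) ℓ q W T) (hW' : middle n f ℓ q ≤ W.card) : V ⊆ T := by
  obtain ⟨k, hk⟩ := R.reads_quorum hV
  obtain ⟨k', hk'⟩ := R.reads_quorum hW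
  rcases le_total (completion f G ℓ q V) (completion f G ℓ q W) with h | h
  · exact R.subset_of_completion_le hW hk h
  · have := Finset.card_le_card (R.subset_of_completion_le hV hk' h)
    omega

/-- The upper child inherits the bound `H` of its parent and has a larger threshold, which halves
the width. The lower child keeps the threshold and gets a smaller bound. For the order, only the two
children of one parent need a new argument, `low_subset_high`. -/
theorem levelInvariant_succ (R : Run f F x G) {ℓ : ℕ} (hℓ : ℓ < depth f)
    (I : LevelInvariant f (total G) ℓ) : LevelInvariant f (total G) (ℓ + 1) where
  le_card q V v := by
    obtain ⟨V₀, h₀, hsub⟩ := R.exists_entry_subset v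
    refine le_trans ?_ (Finset.card_le_card hsub)
    cases h₀ with
    | low _ q _ U r _ card =>
      rw [threshold_two_mul hℓ]
      exact I.le_card q V₀ (R.reads_valid r)
    | high _ q W _ r _ card => exact card.trans (Finset.card_le_card (R.reads_subset r))
  bounded q' := by
    obtain ⟨q, hq⟩ : ∃ q, q' = 2 * q ∨ q' = 2 * q + 1 := ⟨q' / 2, by omega⟩
    obtain ⟨H, hH, hsub⟩ := I.bounded q
    have hreads : ∀ V U, Reads f (total G) ℓ q V U → U ⊆ H := by
      rintro _ _ ⟨Q, S, a, v, rfl⟩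
      exact hsub _ (.join ℓ q _ Q S a v)
    rcases hq with rfl | rfl
    · set L : Set (Value n X) :=
        {V | ∃ U, Reads f (total G) ℓ q V U ∧ U.card < middle n f ℓ q} with hL
      have hfin : L.Finite := by
        refine (Finset.finite_toSet H.powerset).subset ?_
        rintro V ⟨U, r, -⟩
        simpa using (R.reads_subset r).trans (hreads _ _ r)
      have hentry : ∀ V₀, Entry f (total G) (ℓ + 1) (2 * q) V₀ → V₀ ∈ L := by
        intro V₀ h₀
        generalize hr : 2 * q = r at h₀
        cases h₀ with
        | low _ p _ U r _ card =>
          obtain rfl : q = p := by omega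
          exact ⟨U, r, card⟩
        | high _ p _ U r _ card => omega
      rcases L.eq_empty_or_nonempty with hem | hne
      · refine ⟨∅, by simp, fun V v => subset_of_entries v fun V₀ h₀ => ?_⟩
        simpa [hem] using hentry V₀ h₀
      -- The low value `W` completed last has read all the others, so the result `U` of its read
      -- bounds the whole lower child; a maximum exists as all low values are subsets of `H`.
      · obtain ⟨W, ⟨U, rW, hU⟩, hmax⟩ := Set.exists_max_image L (completion f G ℓ q) hfin hne
        refine ⟨U, by rwa [← middle_eq], fun V v => subset_of_entries v fun V₀ h₀ => ?_⟩
        obtain ⟨U₀, r₀, -⟩ := hentry V₀ h₀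
        obtain ⟨k, hk⟩ := R.reads_quorum r₀
        exact R.subset_of_completion_le rW hk (hmax V₀ (hentry V₀ h₀))
    · refine ⟨H, ?_, fun V v => subset_of_entries v fun V₀ h₀ => ?_⟩
      · have h1 := middle_eq (n := n) (f := f) ℓ q
        have h2 := threshold_two_mul (n := n) hℓ q
        have h3 := two_pow_depth_sub hℓ
        unfold middle at h1
        omega
      · generalize hr : 2 * q + 1 = r at h₀
        cases h₀ with
        | low _ p _ U r _ card => omega
        | high _ p _ U r _ card =>
          obtain rfl : q = p := by omega
          exact hreads _ _ r
  ordered q q' V V' hqq v v' := by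
    have hjoin : ∀ {q V U}, Reads f (total G) ℓ q V U → Valid f (total G) ℓ q U := by
      rintro q _ _ ⟨Q, S, a, v, rfl⟩
      exact .join ℓ q _ Q S a v
    obtain ⟨W', h', hsub'⟩ := R.exists_entry_subset v'
    refine (subset_of_entries v fun W h => ?_).trans hsub'
    cases h with
    | low _ p _ U r _ card =>
      cases h' with
      | low _ p' _ U' r' _ card' =>
        exact I.ordered p p' _ _ (by omega) (R.reads_valid r) (R.reads_valid r')
      | high _ p' T _ r' _ card' =>
        rcases Nat.lt_or_ge p p' with hp | hp
        · exact I.ordered p p' _ _ hp (R.reads_valid r) (hjoin r')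
        · obtain rfl : p = p' := by omega
          exact R.low_subset_high r card r' card'
    | high _ p T _ r _ card =>
      cases h' with
      | low _ p' _ U' r' _ card' =>
        exact I.ordered p p' _ _ (by omega) (hjoin r) (R.reads_valid r')
      | high _ p' T _ r' _ card' => exact I.ordered p p' _ _ (by omega) (hjoin r) (hjoin r')

theorem levelInvariant (R : Run f F x G) {ℓ : ℕ} (hℓ : ℓ ≤ depth f) :
    LevelInvariant f (total G) ℓ := by
  induction ℓ with
  | zero => exact R.levelInvariant_zero
  | succ ℓ ih => exact R.levelInvariant_succ hℓ (ih (by omega))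

/-- The values in the groups of the last level form a chain. -/
theorem comparable (R : Run f F x G) {q q' : ℕ} {V V' : Value n X}
    (v : Valid f (total G) (depth f) q V) (v' : Valid f (total G) (depth f) q' V') :
    V ⊆ V' ∨ V' ⊆ V := by
  have I := R.levelInvariant le_rfl
  rcases lt_trichotomy q q' with h | rfl | h
  · exact .inl (I.ordered _ _ _ _ h v v')
  · obtain ⟨H, hH, hsub⟩ := I.bounded q
    -- The width is now `2 ^ 0 = 1`: `H` has no more elements than the threshold, and `V'` has at
    -- least as many, so `V' = H`.
    simp only [Nat.sub_self, pow_zero] at hH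
    have h1 := I.le_card _ _ v'
    rw [Finset.eq_of_subset_of_card_le (hsub V' v') (by omega)]
    exact .inl (hsub V v)
  · exact .inr (I.ordered _ _ _ _ h v' v)

end Run

end GroupSafety

section Protocol

variable {n f : ℕ} {X : Type u}

/-! ### The protocol -/

/-- The position of a query in the order in which a process asks them. -/
def slot (n f : ℕ) : Query n X → ℕ
  | .certify => 0
  | .publish => 1
  | .write ℓ q V => 4 * ℓ + 2 + if middle n f ℓ q ≤ V.card then 2 else 0
  | .read ℓ q V => 4 * ℓ + 3 + if middle n f ℓ q ≤ V.card then 2 else 0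

/-- In view of the signatures in `K`, process `s` may answer a query of process `j` by signing a
datum. -/
inductive Grants (f : ℕ) (s : Fin n) (K : Sigs n X) (j : Fin n) :
    Query n X → Datum n X → Prop
  | certify (y : X) (mem : (j, Msg.data (.input y)) ∈ K) : Grants f s K j .certify (.certified j y)
  | write (ℓ q : ℕ) (V : Value n X) (lt : ℓ < depth f) (valid : Valid f K ℓ q V) :
      Grants f s K j (.write ℓ q V) (.wrote ℓ q V)
  | read (ℓ q : ℕ) (V : Value n X) (S : Finset (Value n X)) (lt : ℓ < depth f)
      (quorum : Quorum f K (.wrote ℓ q V))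
      (mem_iff : ∀ W, W ∈ S ↔ (s, Msg.data (.wrote ℓ q W)) ∈ K) :
      Grants f s K j (.read ℓ q V) (.saw ℓ q V S)

/-- In view of the signatures in `K`, process `i` may proceed from one query to another. -/
inductive Next (f : ℕ) (i : Fin n) (K : Sigs n X) : Query n X → Query n X → Prop
  | publish (y : X) (quorum : Quorum f K (.certified i y)) : Next f i K .certify .publish
  | start (V : Value n X) (y : X) (cert : ∀ e ∈ V, Quorum f K (.certified e.1 e.2))
      (card : n - f ≤ V.card) (own : (i, y) ∈ V) : Next f i K .publish (.write 0 0 V)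
  | read (ℓ q : ℕ) (V : Value n X) (lt : ℓ < depth f) (quorum : Quorum f K (.wrote ℓ q V)) :
      Next f i K (.write ℓ q V) (.read ℓ q V)
  | join (ℓ q : ℕ) (V U : Value n X) (lt : ℓ < depth f) (reads : Reads f K ℓ q V U)
      (card : V.card < middle n f ℓ q) (card' : middle n f ℓ q ≤ U.card) :
      Next f i K (.read ℓ q V) (.write ℓ q U)
  | low (ℓ q : ℕ) (V U : Value n X) (lt : ℓ < depth f) (reads : Reads f K ℓ q V U)
      (card : U.card < middle n f ℓ q) : Next f i K (.read ℓ q V) (.write (ℓ + 1) (2 * q) V)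
  | high (ℓ q : ℕ) (V U : Value n X) (lt : ℓ < depth f) (reads : Reads f K ℓ q V U)
      (card : middle n f ℓ q ≤ V.card) :
      Next f i K (.read ℓ q V) (.write (ℓ + 1) (2 * q + 1) U)

/-- The state of a process: everything that it has received and signed, its current query, and the
queries that it has answered. -/
structure Local (n : ℕ) (X : Type u) : Type u where
  bag : Msg n (Datum n X)
  query : Query n X
  answered : Finset (Fin n × ℕ)

/-- A request carries everything that its sender knows. -/
def requestMsg (r : Query n X) (b : Msg n (Datum n X)) : Msg n (Datum n X) :=
  .pair (.data (.request r)) b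

/-- The query in a request. -/
def asked : Msg n (Datum n X) → Option (Query n X)
  | .pair (.data (.request r)) _ => some r
  | _ => none

/-- Send a request to everybody. -/
def broadcast (r : Query n X) (b : Msg n (Datum n X)) : List (Fin n × Msg n (Datum n X)) :=
  (List.finRange n).map fun d => (d, requestMsg r b)

/-- Receive a message and answer the query in it, if any. -/
inductive Served (f : ℕ) (i : Fin n) (st : Local n X) (j : Fin n) (m : Msg n (Datum n X)) :
    Local n X → List (Fin n × Msg n (Datum n X)) → Prop
  | silent (h : ∀ r φ, asked m = some r → (j, slot n f r) ∉ st.answered →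
      ¬ Grants f i (st.bag.pair m).sigs j r φ) :
      Served f i st j m ⟨st.bag.pair m, st.query, st.answered⟩ []
  | reply (r : Query n X) (φ : Datum n X) (ask : asked m = some r)
      (fresh : (j, slot n f r) ∉ st.answered) (grants : Grants f i (st.bag.pair m).sigs j r φ) :
      Served f i st j m
        ⟨.pair (.sign i (.data φ)) (st.bag.pair m), st.query, insert (j, slot n f r) st.answered⟩
        [(j, .pair (.sign i (.data φ)) (st.bag.pair m))]

/-- Proceed to the next query, if possible. -/
inductive Advanced (f : ℕ) (i : Fin n) (st : Local n X) :
    Local n X → List (Fin n × Msg n (Datum n X)) → Prop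
  | stay (h : ∀ r, ¬ Next f i st.bag.sigs st.query r) : Advanced f i st st []
  | next (r : Query n X) (h : Next f i st.bag.sigs st.query r) :
      Advanced f i st ⟨st.bag, r, st.answered⟩ (broadcast r st.bag)

theorem exists_served (f : ℕ) (i : Fin n) (st : Local n X) (j : Fin n) (m : Msg n (Datum n X)) :
    ∃ p : Local n X × List (Fin n × Msg n (Datum n X)), Served f i st j m p.1 p.2 := by
  by_cases h : ∃ r φ, asked m = some r ∧ (j, slot n f r) ∉ st.answered ∧
      Grants f i (st.bag.pair m).sigs j r φ
  · obtain ⟨r, φ, h₁, h₂, h₃⟩ := h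
    exact ⟨⟨_, _⟩, .reply r φ h₁ h₂ h₃⟩
  · push Not at h
    exact ⟨⟨_, _⟩, .silent h⟩

theorem exists_advanced (f : ℕ) (i : Fin n) (st : Local n X) :
    ∃ p : Local n X × List (Fin n × Msg n (Datum n X)), Advanced f i st p.1 p.2 := by
  by_cases h : ∃ r, Next f i st.bag.sigs st.query r
  · obtain ⟨r, h⟩ := h
    exact ⟨⟨_, _⟩, .next r h⟩
  · push Not at h
    exact ⟨⟨_, _⟩, .stay h⟩

/-- The reaction to a message: answer it, then proceed. -/
noncomputable def react (f : ℕ) (i : Fin n) (st : Local n X) (j : Fin n)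
    (m : Msg n (Datum n X)) : Local n X × List (Fin n × Msg n (Datum n X)) :=
  let a := (exists_served f i st j m).choose
  let b := (exists_advanced f i a.1).choose
  (b.1, a.2 ++ b.2)

/-- `Served` and `Advanced` may allow several outcomes, of which `react` chooses one. Later
arguments use this specification only, so they hold for every choice. -/
theorem react_spec (f : ℕ) (i : Fin n) (st : Local n X) (j : Fin n) (m : Msg n (Datum n X)) :
    ∃ st₁ o₁ o₂, Served f i st j m st₁ o₁ ∧ Advanced f i st₁ (react f i st j m).1 o₂ ∧
      (react f i st j m).2 = o₁ ++ o₂ :=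
  ⟨_, _, _, (exists_served f i st j m).choose_spec, (exists_advanced f i _).choose_spec, rfl⟩

/-- The join of the inputs in a value. -/
noncomputable def decision [SemilatticeSup X] (V : Value n X) : Option X :=
  open Classical in if h : V.Nonempty then some (V.sup' h Prod.snd) else none

/-- The value decided in a state: the process has reached the last level. -/
noncomputable def result [SemilatticeSup X] (f : ℕ) (st : Local n X) : Option X :=
  match st.query with
  | .write ℓ _ V => if ℓ = depth f then decision V else none
  | _ => none

/-- The initial state. -/
def initial (i : Fin n) (x : X) : Local n X := ⟨.sign i (.data (.input x)), .certify, ∅⟩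

/-- Lattice agreement by repeated halving of groups. -/
noncomputable abbrev protocol (n f : ℕ) (X : Type u) [SemilatticeSup X] : Protocol n X where
  State := Local n X
  Data := Datum n X
  start i x := (initial i x, broadcast .certify (initial i x).bag)
  step := react f
  output := result f

/-! ### Reactions -/

theorem sigs_pair {D : Type u} (a b : Msg n D) : (Msg.pair a b).sigs = a.sigs ∪ b.sigs := rfl

theorem sigs_sign_data {D : Type u} (i : Fin n) (d : D) :
    (Msg.sign i (.data d)).sigs = {(i, .data d)} := by
  simp [Msg.sigs]

theorem sigs_requestMsg (r : Query n X) (b : Msg n (Datum n X)) :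
    (requestMsg r b).sigs = b.sigs := by
  simp [requestMsg, Msg.sigs]

theorem mem_broadcast {r : Query n X} {b : Msg n (Datum n X)} {o : Fin n × Msg n (Datum n X)} :
    o ∈ broadcast r b ↔ o.2 = requestMsg r b := by
  constructor
  · intro h
    obtain ⟨d, -, rfl⟩ := List.mem_map.1 h
    rfl
  · intro h
    exact List.mem_map.2 ⟨o.1, List.mem_finRange _, by rw [← h]⟩

section Reaction

variable {i j : Fin n} {st st₁ st' : Local n X} {m : Msg n (Datum n X)}
  {o o₁ o₂ : List (Fin n × Msg n (Datum n X))}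

theorem Served.sigs_subset (h : Served f i st j m st₁ o) :
    (st.bag.pair m).sigs ⊆ st₁.bag.sigs := by
  cases h with
  | silent => exact subset_rfl
  | reply r φ => exact Set.subset_union_right

theorem Served.query_eq (h : Served f i st j m st₁ o) : st₁.query = st.query := by
  cases h <;> rfl

theorem Served.out_sigs (h : Served f i st j m st₁ o) :
    ∀ e ∈ o, e.2 = st₁.bag ∧ asked e.2 = none := by
  cases h with
  | silent => simp
  | reply r φ => simp [asked]

theorem Served.mem_sigs (h : Served f i st j m st₁ o) {a : Fin n × Msg n (Datum n X)}
    (ha : a ∈ st₁.bag.sigs) : a ∈ (st.bag.pair m).sigs ∨ ∃ r φ, asked m = some r ∧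
      (j, slot n f r) ∉ st.answered ∧ Grants f i (st.bag.pair m).sigs j r φ ∧
      a = (i, .data φ) ∧ st₁.answered = insert (j, slot n f r) st.answered := by
  cases h with
  | silent => exact .inl ha
  | reply r φ ask fresh grants =>
    rw [sigs_pair, sigs_sign_data] at ha
    rcases ha with ha | ha
    · exact .inr ⟨r, φ, ask, fresh, grants, ha, rfl⟩
    · exact .inl ha

theorem Served.answered_subset (h : Served f i st j m st₁ o) : st.answered ⊆ st₁.answered := by
  cases h with
  | silent => exact subset_rfl
  | reply r φ => exact Finset.subset_insert _ _

theorem Advanced.bag_eq (h : Advanced f i st st' o) : st'.bag = st.bag := by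
  cases h <;> rfl

theorem Advanced.answered_eq (h : Advanced f i st st' o) : st'.answered = st.answered := by
  cases h <;> rfl

theorem Advanced.out_sigs (h : Advanced f i st st' o) :
    ∀ e ∈ o, e.2 = requestMsg st'.query st.bag := by
  cases h with
  | stay => simp
  | next r => exact fun e he => mem_broadcast.1 he

end Reaction

/-- Process `i` receives `m` from `j` in the configuration `c`, which becomes `c'`. -/
structure Receives [SemilatticeSup X] (c c' : Config (protocol n f X)) (i j : Fin n)
    (m : Msg n (Datum n X)) (st₁ : Local n X) (o₁ o₂ : List (Fin n × Msg n (Datum n X))) : Prop where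
  served : Served f i (c.state i) j m st₁ o₁
  advanced : Advanced f i st₁ (c'.state i) o₂
  state_ne : ∀ s, s ≠ i → c'.state s = c.state s
  sent : c'.sent = c.sent ++ envelopes i (o₁ ++ o₂)

variable [SemilatticeSup X] {F : Finset (Fin n)} {c c' : Config (protocol n f X)}

theorem receives_receive (c : Config (protocol n f X)) (i j : Fin n) (m : Msg n (Datum n X))
    (D : Set ℕ) :
    ∃ st₁ o₁ o₂, Receives c { c.receive i j m with delivered := D } i j m st₁ o₁ o₂ := by
  obtain ⟨st₁, o₁, o₂, h₁, h₂, h₃⟩ := react_spec f i (c.state i) j m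
  refine ⟨st₁, o₁, o₂, h₁, ?_, fun s hs => ?_, ?_⟩
  · simpa [Config.receive] using h₂
  · simp [Config.receive, hs]
  · simp only [Config.receive, ← h₃]

/-- The possible events. -/
theorem step_cases (h : Step F c c') :
    c' = c ∨ ∃ i j m st₁ o₁ o₂, i ∉ F ∧ Receives c c' i j m st₁ o₁ o₂ ∧
      ((∃ id, c.sent[id]? = some ⟨j, i, m⟩ ∧ c'.delivered = insert id c.delivered) ∨
        (j ∈ F ∧ c'.delivered = c.delivered ∧
          ∀ a ∈ m.sigs, a.1 ∉ F → ∃ e ∈ c.sent, e.src = a.1 ∧ a ∈ e.msg.sigs)) := by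
  cases h with
  | idle => exact .inl rfl
  | deliver id e sent pending correct =>
    obtain ⟨st₁, o₁, o₂, h⟩ := receives_receive c e.dst e.src e.msg (insert id c.delivered)
    exact .inr ⟨_, _, _, st₁, o₁, o₂, correct, h, .inl ⟨id, sent, rfl⟩⟩
  | byzantine i j m correct faulty unforgeable =>
    obtain ⟨st₁, o₁, o₂, h⟩ := receives_receive c i j m c.delivered
    exact .inr ⟨_, _, _, st₁, o₁, o₂, correct, h, .inr ⟨faulty, rfl, unforgeable⟩⟩

namespace Receives

variable {i j : Fin n} {m : Msg n (Datum n X)} {st₁ : Local n X}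
  {o₁ o₂ : List (Fin n × Msg n (Datum n X))}

theorem bag_eq (h : Receives c c' i j m st₁ o₁ o₂) : (c'.state i).bag = st₁.bag :=
  h.advanced.bag_eq

theorem pair_sigs_subset (h : Receives c c' i j m st₁ o₁ o₂) :
    ((c.state i).bag.pair m).sigs ⊆ (c'.state i).bag.sigs := by
  rw [h.bag_eq]
  exact h.served.sigs_subset

theorem bag_mono (h : Receives c c' i j m st₁ o₁ o₂) (s : Fin n) :
    (c.state s).bag.sigs ⊆ (c'.state s).bag.sigs := by
  by_cases hs : s = i
  · subst hs
    exact Set.subset_union_left.trans h.pair_sigs_subset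
  · rw [h.state_ne s hs]

theorem out_sigs (h : Receives c c' i j m st₁ o₁ o₂) {e : Fin n × Msg n (Datum n X)}
    (he : e ∈ o₁ ++ o₂) : e.2.sigs = (c'.state i).bag.sigs := by
  rw [h.bag_eq]
  rcases List.mem_append.1 he with he | he
  · rw [(h.served.out_sigs e he).1]
  · rw [h.advanced.out_sigs e he, sigs_requestMsg]

end Receives

theorem mem_envelopes {D : Type u} {i : Fin n} {l : List (Fin n × Msg n D)} {e : Envelope n D} :
    e ∈ envelopes i l ↔ e.src = i ∧ (e.dst, e.msg) ∈ l := by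
  constructor
  · intro h
    obtain ⟨o, ho, rfl⟩ := List.mem_map.1 h
    exact ⟨rfl, ho⟩
  · rintro ⟨h, h'⟩
    exact List.mem_map.2 ⟨_, h', by rw [← h]⟩

theorem Receives.mem_sent {i j : Fin n} {m : Msg n (Datum n X)} {st₁ : Local n X}
    {o₁ o₂ : List (Fin n × Msg n (Datum n X))} (h : Receives c c' i j m st₁ o₁ o₂)
    {e : Envelope n (Datum n X)} :
    e ∈ c'.sent ↔ e ∈ c.sent ∨ e.src = i ∧ (e.dst, e.msg) ∈ o₁ ++ o₂ := by
  rw [h.sent, List.mem_append, mem_envelopes]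

/-- The signatures in an outgoing message are exactly those in the bag of its sender, and the bag
consists of received messages and own signatures. -/
theorem signsHonestly (n f : ℕ) : (protocol n f X).SignsHonestly := by
  have hloc : ∀ (i : Fin n) (x : X) (h : List (Fin n × Msg n (Datum n X))),
      ∀ a ∈ (Local.bag ((protocol n f X).localState i x h)).sigs,
        a.1 = i ∨ ∃ e ∈ h, a ∈ e.2.sigs := by
    intro i x h
    induction h using List.reverseRecOn with
    | nil =>
      intro a ha
      have ha : a ∈ (Msg.sign i (.data (Datum.input (n := n) x))).sigs := ha
      rw [sigs_sign_data] at ha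
      exact .inl (congrArg Prod.fst ha)
    | append_singleton h e ih =>
      intro a ha
      simp only [Protocol.localState, List.foldl_append, List.foldl_cons, List.foldl_nil] at ha ih
      obtain ⟨st₁, o₁, o₂, h₁, h₂, -⟩ := react_spec f i
        (h.foldl (fun s e => (react f i s e.1 e.2).1) (initial i x)) e.1 e.2
      rw [h₂.bag_eq] at ha
      rcases h₁.mem_sigs ha with ha | ⟨r, φ, -, -, -, ha, -⟩
      · rcases ha with ha | ha
        · rcases ih a ha with h | ⟨e', he', h⟩
          · exact .inl h
          · exact .inr ⟨e', by simp [he'], h⟩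
        · exact .inr ⟨e, by simp, ha⟩
      · exact .inl (congrArg Prod.fst ha)
  constructor
  · intro i x o ho a ha
    rw [mem_broadcast.1 ho, sigs_requestMsg] at ha
    rcases hloc i x [] a ha with h | ⟨e, he, -⟩
    · exact h
    · simp at he
  · intro i x h j m o ho a ha
    have key := hloc i x (h ++ [(j, m)]) a
    simp only [Protocol.localState, List.foldl_append, List.foldl_cons, List.foldl_nil] at key ho
    obtain ⟨st₁, o₁, o₂, h₁, h₂, h₃⟩ := react_spec f i
      (h.foldl (fun s e => (react f i s e.1 e.2).1) (initial i x)) j m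
    have : o.2.sigs = st₁.bag.sigs := by
      rw [h₃] at ho
      rcases List.mem_append.1 ho with ho | ho
      · rw [(h₁.out_sigs o ho).1]
      · rw [h₂.out_sigs o ho, sigs_requestMsg]
    rw [h₂.bag_eq, ← this] at key
    rcases key ha with h | ⟨e, he, h⟩
    · exact .inl h
    · rcases List.mem_append.1 he with he | he
      · exact .inr (.inr ⟨e, he, h⟩)
      · obtain rfl := List.mem_singleton.1 he
        exact .inr (.inl h)

/-! ### Safety -/

/-- The signatures that exist in a configuration, where nothing is known about those of faulty
processes. -/
def issued (F : Finset (Fin n)) (c : Config (protocol n f X)) : Sigs n X :=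
  {a | a.1 ∈ F ∨ a ∈ (c.state a.1).bag.sigs}

/-- What correct processes have signed and sent. -/
structure SigInvariant (F : Finset (Fin n)) (x : Fin n → X) (c : Config (protocol n f X)) :
    Prop where
  src_correct : ∀ e ∈ c.sent, e.src ∉ F
  sent_sigs : ∀ e ∈ c.sent, e.msg.sigs ⊆ (c.state e.src).bag.sigs
  bag_issued : ∀ i ∉ F, (c.state i).bag.sigs ⊆ issued F c
  input_eq : ∀ s ∉ F, ∀ y, (s, Msg.data (.input y)) ∈ (c.state s).bag.sigs → y = x s
  certified_input : ∀ s ∉ F, ∀ j y, (s, Msg.data (.certified j y)) ∈ (c.state s).bag.sigs →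
    (j, 0) ∈ (c.state s).answered ∧ (j, Msg.data (.input y)) ∈ (c.state s).bag.sigs
  certified_unique : ∀ s ∉ F, ∀ j y z, (s, Msg.data (.certified j y)) ∈ (c.state s).bag.sigs →
    (s, Msg.data (.certified j z)) ∈ (c.state s).bag.sigs → y = z
  wrote_valid : ∀ s ∉ F, ∀ ℓ q V, (s, Msg.data (.wrote ℓ q V)) ∈ (c.state s).bag.sigs →
    Valid f (c.state s).bag.sigs ℓ q V

theorem mem_sent_initial {x : Fin n → X} {e : Envelope n (Datum n X)} :
    e ∈ (Config.initial (protocol n f X) F x).sent ↔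
      e.src ∉ F ∧ e.msg = requestMsg .certify (initial e.src (x e.src)).bag := by
  simp only [Config.initial, List.mem_flatMap, List.mem_filter, List.mem_finRange, true_and,
    mem_envelopes, decide_eq_true_eq, mem_broadcast]
  constructor
  · rintro ⟨i, hi, rfl, h⟩
    exact ⟨hi, h⟩
  · rintro ⟨hi, h⟩
    exact ⟨_, hi, rfl, h⟩

theorem sigs_initial (x : Fin n → X) (s : Fin n) :
    (Local.bag ((Config.initial (protocol n f X) F x).state s)).sigs =
      {(s, .data (.input (x s)))} :=
  sigs_sign_data s _

theorem sigInvariant_initial (F : Finset (Fin n)) (x : Fin n → X) :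
    SigInvariant F x (Config.initial (protocol n f X) F x) where
  src_correct e he := (mem_sent_initial.1 he).1
  sent_sigs e he := by
    rw [(mem_sent_initial.1 he).2, sigs_requestMsg]
    exact subset_rfl
  bag_issued i _ a ha := by
    refine .inr ?_
    rw [sigs_initial] at ha ⊢
    obtain rfl := ha
    rfl
  input_eq s _ y h := by
    rw [sigs_initial] at h
    simpa using h
  certified_input s _ j y h := by
    rw [sigs_initial] at h
    simp at h
  certified_unique s _ j y z h := by
    rw [sigs_initial] at h
    simp at h
  wrote_valid s _ ℓ q V h := by
    rw [sigs_initial] at h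
    simp at h

theorem issued_mono_of_receives {i j : Fin n} {m : Msg n (Datum n X)} {st₁ : Local n X}
    {o₁ o₂ : List (Fin n × Msg n (Datum n X))} (h : Receives c c' i j m st₁ o₁ o₂) :
    issued F c ⊆ issued F c' := by
  rintro a (ha | ha)
  · exact .inl ha
  · exact .inr (h.bag_mono _ ha)

/-- Everything that arrives has been issued. -/
theorem SigInvariant.msg_issued {x : Fin n → X} (I : SigInvariant F x c) {i j : Fin n}
    {m : Msg n (Datum n X)}
    (h : (∃ id, c.sent[id]? = some ⟨j, i, m⟩ ∧ c'.delivered = insert id c.delivered) ∨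
        (j ∈ F ∧ c'.delivered = c.delivered ∧
          ∀ a ∈ m.sigs, a.1 ∉ F → ∃ e ∈ c.sent, e.src = a.1 ∧ a ∈ e.msg.sigs)) :
    m.sigs ⊆ issued F c := by
  intro a ha
  rcases h with ⟨id, h, -⟩ | ⟨-, -, h⟩
  · have he := List.mem_of_getElem? h
    exact I.bag_issued _ (I.src_correct _ he) (I.sent_sigs _ he ha)
  · by_cases haF : a.1 ∈ F
    · exact .inl haF
    · obtain ⟨e, he, hsrc, hae⟩ := h a ha haF
      have := I.sent_sigs e he hae
      rw [hsrc] at this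
      exact .inr this

/-- A correct process signs only what it grants. -/
theorem Receives.mem_sigs {i j : Fin n}
    {m : Msg n (Datum n X)} (hm : m.sigs ⊆ issued F c) {st₁ : Local n X}
    {o₁ o₂ : List (Fin n × Msg n (Datum n X))} (hi : i ∉ F)
    (h : Receives c c' i j m st₁ o₁ o₂) {p : Msg n (Datum n X)}
    (hp : (i, p) ∈ (c'.state i).bag.sigs) : (i, p) ∈ (c.state i).bag.sigs ∨
      ∃ r φ, asked m = some r ∧ (j, slot n f r) ∉ (c.state i).answered ∧
      Grants f i ((c.state i).bag.pair m).sigs j r φ ∧ p = .data φ ∧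
      (c'.state i).answered = insert (j, slot n f r) (c.state i).answered := by
  rw [h.bag_eq] at hp
  rcases h.served.mem_sigs hp with (hp | hp) | ⟨r, φ, h₁, h₂, h₃, h₄, h₅⟩
  · exact .inl hp
  · rcases hm hp with h | h
    · exact absurd h hi
    · exact .inl h
  · exact .inr ⟨r, φ, h₁, h₂, h₃, congrArg Prod.snd h₄, by rw [h.advanced.answered_eq, h₅]⟩

theorem SigInvariant.step {x : Fin n → X} (I : SigInvariant F x c) (hstep : Step F c c') :
    SigInvariant F x c' := by
  rcases step_cases hstep with rfl | ⟨i, j, m, st₁, o₁, o₂, hi, h, hsrc⟩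
  · exact I
  have hm := I.msg_issued hsrc
  have hpair : ((c.state i).bag.pair m).sigs ⊆ issued F c :=
    Set.union_subset (I.bag_issued i hi) hm
  constructor
  · intro e he
    rcases h.mem_sent.1 he with he | ⟨rfl, -⟩
    · exact I.src_correct e he
    · exact hi
  · intro e he
    rcases h.mem_sent.1 he with he | ⟨rfl, he⟩
    · exact (I.sent_sigs e he).trans (h.bag_mono _)
    · exact (h.out_sigs he).subset
  · intro s hs
    by_cases hsi : s = i
    · subst hsi
      rintro ⟨a, p⟩ ha
      by_cases hai : a = s
      · subst hai
        exact .inr ha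
      · rw [h.bag_eq] at ha
        rcases h.served.mem_sigs ha with ha | ⟨r, φ, -, -, -, ha, -⟩
        · exact issued_mono_of_receives h (hpair ha)
        · exact absurd (congrArg Prod.fst ha) hai
    · rw [h.state_ne s hsi]
      exact (I.bag_issued s hs).trans (issued_mono_of_receives h)
  · intro s hs y hy
    by_cases hsi : s = i
    · subst hsi
      rcases h.mem_sigs hm hs hy with hy | ⟨r, φ, -, -, g, hφ, -⟩
      · exact I.input_eq s hs y hy
      · cases g <;> cases hφ
    · rw [h.state_ne s hsi] at hy
      exact I.input_eq s hs y hy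
  · intro s hs k y hy
    by_cases hsi : s = i
    · subst hsi
      rcases h.mem_sigs hm hs hy with hy | ⟨r, φ, -, -, g, hφ, hans⟩
      · obtain ⟨h₁, h₂⟩ := I.certified_input s hs k y hy
        rw [h.advanced.answered_eq]
        exact ⟨h.served.answered_subset h₁, h.bag_mono s h₂⟩
      · cases g <;> cases hφ
        next mem =>
          rw [hans]
          exact ⟨Finset.mem_insert_self _ _, h.pair_sigs_subset mem⟩
    · rw [h.state_ne s hsi] at hy ⊢
      exact I.certified_input s hs k y hy
  · intro s hs k y z hy hz
    by_cases hsi : s = i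
    · subst hsi
      -- A signature of `s` that arrives from outside is one that `s` issued earlier, by
      -- unforgeability.
      have hold : ∀ {w}, (s, Msg.data (.certified k w)) ∈ ((c.state s).bag.pair m).sigs →
          (s, Msg.data (.certified k w)) ∈ (c.state s).bag.sigs := fun hw =>
        (hpair hw).resolve_left hs
      rw [h.bag_eq] at hy hz
      cases h.served with
      | silent => exact I.certified_unique s hs k y z (hold hy) (hold hz)
      | reply r φ ask fresh grants =>
        rw [sigs_pair, sigs_sign_data] at hy hz
        rcases hy with hy | hy <;> rcases hz with hz | hz
        · simpa using hy.trans hz.symm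
        -- One certificate is new and the other is old. The old one has left `(k, 0)` among the
        -- answered pairs, and 0 is the slot of `certify`, so the new one would not have been
        -- granted.
        · obtain rfl : Datum.certified k y = φ := by simpa using hy
          cases grants
          exact absurd (I.certified_input s hs _ z (hold hz)).1 fresh
        · obtain rfl : Datum.certified k z = φ := by simpa using hz
          cases grants
          exact absurd (I.certified_input s hs _ y (hold hy)).1 fresh
        · exact I.certified_unique s hs k y z (hold hy) (hold hz)
    · rw [h.state_ne s hsi] at hy hz
      exact I.certified_unique s hs k y z hy hz
  · intro s hs ℓ q V hV
    by_cases hsi : s = i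
    · subst hsi
      rcases h.mem_sigs hm hs hV with hV | ⟨r, φ, -, -, g, hφ, -⟩
      · exact (I.wrote_valid s hs ℓ q V hV).mono (h.bag_mono s)
      · cases g <;> cases hφ
        next valid => exact valid.mono h.pair_sigs_subset
    · rw [h.state_ne s hsi] at hV ⊢
      exact I.wrote_valid s hs ℓ q V hV

/-! ### The invariants along an execution, which instantiate the abstract history -/

section Execution

variable {x : Fin n → X} (E : Execution (protocol n f X) F x)

theorem sigInvariant (k : ℕ) : SigInvariant F x (E.conf k) := by
  induction k with
  | zero =>
    rw [E.conf_zero]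
    exact sigInvariant_initial F x
  | succ k ih => exact ih.step (E.step k)

theorem monotone_of_step {α : Type*} [Preorder α] (φ : Config (protocol n f X) → α)
    (h : ∀ c c' : Config (protocol n f X), Step F c c' → φ c ≤ φ c') :
    Monotone fun k => φ (E.conf k) :=
  monotone_nat_of_le_succ fun k => h _ _ (E.step k)

theorem bag_mono (s : Fin n) : Monotone fun k => (Local.bag ((E.conf k).state s)).sigs :=
  monotone_of_step E (fun c => (Local.bag (c.state s)).sigs) fun c c' h => by
    rcases step_cases h with rfl | ⟨i, j, m, st₁, o₁, o₂, -, h, -⟩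
    · exact le_rfl
    · exact h.bag_mono s

/-- The witness is the configuration in which the signer is about to process the request: the quorum
that it verifies consists of signatures already issued, and its report contains all that it has
accepted so far. -/
theorem saw_after (k : ℕ) : ∀ s ∉ F, ∀ ℓ q V S,
    (s, Msg.data (.saw ℓ q V S)) ∈ issued F (E.conf k) →
    ∃ k', Quorum f (issued F (E.conf k')) (.wrote ℓ q V) ∧
      ∀ W, (s, Msg.data (.wrote ℓ q W)) ∈ issued F (E.conf k') → W ∈ S := by
  intro s hs ℓ q V S h
  replace h := h.resolve_left hs
  induction k with
  | zero =>
    rw [E.conf_zero, sigs_initial] at h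
    simp at h
  | succ k ih =>
    have I := sigInvariant E k
    rcases step_cases (E.step k) with hc | ⟨i, j, m, st₁, o₁, o₂, hi, hr, hsrc⟩
    · rw [hc] at h
      exact ih h
    by_cases hsi : s = i
    · subst hsi
      have hm := I.msg_issued hsrc
      rcases hr.mem_sigs hm hs h with h | ⟨r, φ, -, -, g, hφ, -⟩
      · exact ih h
      · cases g <;> cases hφ
        next lt quorum mem_iff =>
          refine ⟨k, quorum.mono (Set.union_subset (I.bag_issued s hs) hm), fun W hW => ?_⟩
          exact (mem_iff W).2 (.inl (hW.resolve_left hs))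
    · rw [hr.state_ne s hsi] at h
      exact ih h

theorem run (hf : 3 * f < n) (hF : F.card ≤ f) : Run f F x fun k => issued F (E.conf k) where
  resilient := hf
  faulty_card := hF
  mono := by
    rintro k k' h a (ha | ha)
    · exact .inl ha
    · exact .inr (bag_mono E a.1 h ha)
  input_eq k s hs y h := (sigInvariant E k).input_eq s hs y (h.resolve_left hs)
  input_mem k s hs j y h := (sigInvariant E k).bag_issued s hs
    ((sigInvariant E k).certified_input s hs j y (h.resolve_left hs)).2
  certified_unique k s hs j y z h h' := (sigInvariant E k).certified_unique s hs j y z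
    (h.resolve_left hs) (h'.resolve_left hs)
  wrote_valid k s hs ℓ q V h := ((sigInvariant E k).wrote_valid s hs ℓ q V
    (h.resolve_left hs)).mono ((sigInvariant E k).bag_issued s hs)
  saw_after := saw_after E

end Execution

end Protocol

section Requests

variable {n f : ℕ} {X : Type u}

/-! ### Requests and answers -/

/-- The signatures in `K` justify the query of process `i`. -/
def Supported (f : ℕ) (x : Fin n → X) (i : Fin n) (K : Sigs n X) : Query n X → Prop
  | .certify => (i, Msg.data (.input (x i))) ∈ K
  | .publish => Quorum f K (.certified i (x i))
  | .write ℓ q V => Valid f K ℓ q V ∧ ℓ ≤ depth f ∧ (i, x i) ∈ V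
  | .read ℓ q V => Quorum f K (.wrote ℓ q V) ∧ ℓ < depth f ∧ (i, x i) ∈ V

/-- Process `s` has answered the query of process `j`, as is shown by the signatures in `K`. -/
def Acked (f : ℕ) (x : Fin n → X) (s j : Fin n) (K : Sigs n X) : Query n X → Prop
  | .certify => (s, Msg.data (.certified j (x j))) ∈ K
  | .publish => True
  | .write ℓ q V => (s, Msg.data (.wrote ℓ q V)) ∈ K
  | .read ℓ q V => ∃ S, (s, Msg.data (.saw ℓ q V S)) ∈ K ∧ ∀ W ∈ S, Valid f K ℓ q W

/-- The queries that are answered. -/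
def Answerable (f : ℕ) : Query n X → Prop
  | .certify => True
  | .publish => False
  | .write ℓ _ _ => ℓ < depth f
  | .read ℓ _ _ => ℓ < depth f

theorem Supported.mono {x : Fin n → X} {i : Fin n} {K K' : Sigs n X} (h : K ⊆ K')
    {r : Query n X} (s : Supported f x i K r) : Supported f x i K' r := by
  cases r with
  | certify => exact h s
  | publish => exact Quorum.mono h s
  | write ℓ q V => exact ⟨s.1.mono h, s.2⟩
  | read ℓ q V => exact ⟨s.1.mono h, s.2⟩

theorem Acked.mono {x : Fin n → X} {s j : Fin n} {K K' : Sigs n X} (h : K ⊆ K')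
    {r : Query n X} (a : Acked f x s j K r) : Acked f x s j K' r := by
  cases r with
  | certify => exact h a
  | publish => trivial
  | write ℓ q V => exact h a
  | read ℓ q V =>
    obtain ⟨S, hS, hv⟩ := a
    exact ⟨S, h hS, fun W hW => (hv W hW).mono h⟩

theorem Next.mono {i : Fin n} {K K' : Sigs n X} (h : K ⊆ K') {r r' : Query n X}
    (a : Next f i K r r') : Next f i K' r r' := by
  cases a with
  | publish y hq => exact .publish y (hq.mono h)
  | start V y cert card own => exact .start V y (fun e he => (cert e he).mono h) card own
  | read ℓ q V lt hq => exact .read ℓ q V lt (hq.mono h)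
  | join ℓ q V U lt hr card card' => exact .join ℓ q V U lt (hr.mono h) card card'
  | low ℓ q V U lt hr card => exact .low ℓ q V U lt (hr.mono h) card
  | high ℓ q V U lt hr card => exact .high ℓ q V U lt (hr.mono h) card

/-- A level occupies the slots `4 * ℓ + 2` to `4 * ℓ + 5`: write and read of a value below `middle`,
then of one that has reached it. Among the ways to proceed from a read only `join` stays in the
group, and it passes from the first pair of slots to the second. -/
theorem Next.slot_lt {i : Fin n} {K : Sigs n X} {r r' : Query n X} (a : Next f i K r r') :
    slot n f r < slot n f r' := by
  cases a with
  | publish => simp [slot]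
  | start => simp only [slot]; omega
  | read => simp only [slot]; omega
  | join ℓ q V U lt hr card card' =>
    simp only [slot, if_neg (not_le.2 card), if_pos card']
    omega
  | low => simp only [slot]; split_ifs <;> omega
  | high => simp only [slot]; split_ifs <;> omega

/-- The history `R` is needed for the own input: what is certified for a correct `i` is `x i`, and a
read result contains the value written before, so `(i, x i)` is never lost. -/
theorem Next.supported {F : Finset (Fin n)} {x : Fin n → X} {G : ℕ → Sigs n X}
    (R : Run f F x G) {i : Fin n} (hi : i ∉ F) {K : Sigs n X} (hK : K ⊆ total G)
    {r r' : Query n X} (a : Next f i K r r') (s : Supported f x i K r) :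
    Supported f x i K r' := by
  cases a with
  | publish y hq =>
    obtain rfl := R.eq_input_of_certified hi (hq.mono hK)
    exact hq
  | start V y cert card own =>
    obtain rfl := R.eq_input_of_certified hi ((cert _ own).mono hK)
    exact ⟨.init V cert card, Nat.zero_le _, own⟩
  | read ℓ q V lt hq => exact ⟨hq, lt, s.2.2⟩
  | join ℓ q V U lt hr card card' =>
    have hsub := R.reads_subset (hr.mono hK)
    obtain ⟨Q, S, ans, val, rfl⟩ := hr
    exact ⟨.join ℓ q V Q S ans val, lt.le, hsub s.2.2⟩
  | low ℓ q V U lt hr card =>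
    obtain ⟨Q, S, ans, val, rfl⟩ := hr
    exact ⟨.low ℓ q V Q S ans val lt card, lt, s.2.2⟩
  | high ℓ q V U lt hr card =>
    have hsub := R.reads_subset (hr.mono hK)
    obtain ⟨Q, S, ans, val, rfl⟩ := hr
    exact ⟨.high ℓ q V Q S ans val lt card, lt, hsub s.2.2⟩

/-- The bound exceeds `4 * depth f + 2` because `slot` compares with `middle` on the last level too,
although groups are not split there. -/
theorem Supported.slot_le {x : Fin n → X} {i : Fin n} {K : Sigs n X} {r : Query n X}
    (s : Supported f x i K r) : slot n f r ≤ 4 * depth f + 4 := by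
  cases r with
  | certify => simp [slot]
  | publish => simp [slot]
  | write ℓ q V => have := s.2.1; simp only [slot]; split_ifs <;> omega
  | read ℓ q V => have := s.2.1; simp only [slot]; split_ifs <;> omega

theorem Supported.answerable {x : Fin n → X} {i : Fin n} {K : Sigs n X} {r : Query n X}
    (s : Supported f x i K r) (h : slot n f r ≠ 1) (h' : slot n f r < 4 * depth f + 2) :
    Answerable f r := by
  cases r with
  | certify => trivial
  | publish => exact h rfl
  | write ℓ q V => simp only [slot, Answerable] at h' ⊢; omega
  | read ℓ q V => exact s.2.1

theorem Grants.slot_lt {s j : Fin n} {K : Sigs n X} {r : Query n X} {φ : Datum n X}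
    (g : Grants f s K j r φ) : slot n f r < 4 * depth f + 2 := by
  cases g with
  | certify => simp [slot]
  | write ℓ q V lt => simp only [slot]; split_ifs <;> omega
  | read ℓ q V S lt => simp only [slot]; split_ifs <;> omega

theorem finite_sigs {D : Type u} (m : Msg n D) : m.sigs.Finite := by
  induction m with
  | data d => exact Set.finite_empty
  | pair a b ha hb => exact ha.union hb
  | sign i m ih => exact ih.insert _

/-- The request itself contains the justification, so any receiver can answer at once. For reads,
the report is finite because a message contains finitely many signatures. -/
theorem Supported.exists_grants {x : Fin n → X} {s j : Fin n} {m : Msg n (Datum n X)}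
    {r : Query n X} (h : Supported f x j m.sigs r) (a : Answerable f r) :
    ∃ φ, Grants f s m.sigs j r φ := by
  cases r with
  | certify => exact ⟨_, .certify _ h⟩
  | publish => exact a.elim
  | write ℓ q V => exact ⟨_, .write ℓ q V a h.1⟩
  | read ℓ q V =>
    have hfin : {W | (s, Msg.data (Datum.wrote ℓ q W)) ∈ m.sigs}.Finite :=
      (finite_sigs m).preimage fun W _ W' _ h => by simpa using h
    exact ⟨_, .read ℓ q V hfin.toFinset a h.1 fun W => by simp⟩

variable [SemilatticeSup X] {F : Finset (Fin n)} {c c' : Config (protocol n f X)}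

/-- The requests that correct processes have sent. -/
structure RequestInvariant (F : Finset (Fin n)) (x : Fin n → X)
    (c : Config (protocol n f X)) : Prop where
  query_supported : ∀ i ∉ F, Supported f x i (c.state i).bag.sigs (c.state i).query
  current : ∀ i ∉ F, ∀ d, ∃ e ∈ c.sent, e.src = i ∧ e.dst = d ∧
    asked e.msg = some (c.state i).query
  asked_supported : ∀ e ∈ c.sent, ∀ r, asked e.msg = some r → Supported f x e.src e.msg.sigs r
  asked_slot : ∀ e ∈ c.sent, ∀ r, asked e.msg = some r →
    slot n f r < slot n f (c.state e.src).query ∨ r = (c.state e.src).query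
  asked_unique : ∀ e ∈ c.sent, ∀ e' ∈ c.sent, ∀ r r', e.src = e'.src → asked e.msg = some r →
    asked e'.msg = some r' → slot n f r = slot n f r' → r = r'
  published : ∀ i ∉ F, (c.state i).query ≠ .certify → ∀ d, ∃ e ∈ c.sent, e.src = i ∧ e.dst = d ∧
    Quorum f e.msg.sigs (.certified i (x i))

theorem requestInvariant_initial (F : Finset (Fin n)) (x : Fin n → X) :
    RequestInvariant F x (Config.initial (protocol n f X) F x) where
  query_supported i _ := by
    change (i, _) ∈ (Local.bag ((Config.initial (protocol n f X) F x).state i)).sigs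
    rw [sigs_initial]
    rfl
  current i hi d := ⟨⟨i, d, requestMsg .certify (initial i (x i)).bag⟩,
    mem_sent_initial.2 ⟨hi, rfl⟩, rfl, rfl, rfl⟩
  asked_supported e he r hr := by
    obtain ⟨-, h⟩ := mem_sent_initial.1 he
    rw [h] at hr ⊢
    obtain rfl : Query.certify = r := by simpa [requestMsg, asked] using hr
    rw [sigs_requestMsg]
    change (e.src, _) ∈ (Local.bag ((Config.initial (protocol n f X) F x).state e.src)).sigs
    rw [sigs_initial]
    rfl
  asked_slot e he r hr := by
    obtain ⟨-, h⟩ := mem_sent_initial.1 he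
    rw [h] at hr
    right
    obtain rfl : Query.certify = r := by simpa [requestMsg, asked] using hr
    rfl
  asked_unique e he e' he' r r' _ hr hr' _ := by
    rw [(mem_sent_initial.1 he).2] at hr
    rw [(mem_sent_initial.1 he').2] at hr'
    simp only [requestMsg, asked, Option.some.injEq] at hr hr'
    rw [← hr, ← hr']
  published i _ h := absurd rfl h

/-- The outcome of a reaction, as far as requests are concerned: either nothing changes, or the
next query is broadcast. -/
theorem Receives.query_cases {i j : Fin n} {m : Msg n (Datum n X)} {st₁ : Local n X}
    {o₁ o₂ : List (Fin n × Msg n (Datum n X))} (h : Receives c c' i j m st₁ o₁ o₂) :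
    (c'.state i).query = (c.state i).query ∧ o₂ = [] ∧
      (∀ r, ¬ Next f i (c'.state i).bag.sigs (c'.state i).query r) ∨
    Next f i (c'.state i).bag.sigs (c.state i).query (c'.state i).query ∧
      o₂ = broadcast (c'.state i).query (c'.state i).bag := by
  have hadv := h.advanced
  generalize hst : c'.state i = st' at hadv
  cases hadv with
  | stay hn => exact .inl ⟨h.served.query_eq, rfl, hn⟩
  | next r hr =>
    rw [h.served.query_eq] at hr
    exact .inr ⟨hr, rfl⟩

/-- A new request is the one for the new query. -/
theorem Receives.asked_cases {i j : Fin n} {m : Msg n (Datum n X)} {st₁ : Local n X}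
    {o₁ o₂ : List (Fin n × Msg n (Datum n X))} (h : Receives c c' i j m st₁ o₁ o₂)
    {e : Envelope n (Datum n X)} (he : e ∈ c'.sent) {r : Query n X} (hr : asked e.msg = some r) :
    e ∈ c.sent ∨ e.src = i ∧ r = (c'.state i).query ∧
      Next f i (c'.state i).bag.sigs (c.state i).query (c'.state i).query := by
  rcases h.mem_sent.1 he with he | ⟨hsrc, he⟩
  · exact .inl he
  rcases List.mem_append.1 he with he | he
  · rw [(h.served.out_sigs _ he).2] at hr
    cases hr
  · rcases h.query_cases with ⟨-, ho, -⟩ | ⟨hn, ho⟩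
    · simp [ho] at he
    · rw [ho] at he
      have := mem_broadcast.1 he
      simp only at this
      rw [this] at hr
      simp only [requestMsg, asked, Option.some.injEq] at hr
      exact .inr ⟨hsrc, hr.symm, hn⟩

theorem Receives.slot_query {i j : Fin n} {m : Msg n (Datum n X)} {st₁ : Local n X}
    {o₁ o₂ : List (Fin n × Msg n (Datum n X))} (h : Receives c c' i j m st₁ o₁ o₂) (s : Fin n) :
    slot n f (c.state s).query < slot n f (c'.state s).query ∨
      (c.state s).query = (c'.state s).query := by
  by_cases hs : s = i
  · subst hs
    rcases h.query_cases with ⟨hq, -⟩ | ⟨hn, -⟩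
    · exact .inr hq.symm
    · exact .inl hn.slot_lt
  · exact .inr (by rw [h.state_ne s hs])

theorem RequestInvariant.step {x : Fin n → X} {G : ℕ → Sigs n X} (R : Run f F x G)
    (I : RequestInvariant F x c) (I' : SigInvariant F x c') (hG : issued F c' ⊆ total G)
    (hstep : Step F c c') : RequestInvariant F x c' := by
  rcases step_cases hstep with rfl | ⟨i, j, m, st₁, o₁, o₂, hi, h, -⟩
  · exact I
  have hsent : ∀ {e}, e ∈ c.sent → e ∈ c'.sent := fun he => h.mem_sent.2 (.inl he)
  have hsupp : Supported f x i (c'.state i).bag.sigs (c'.state i).query := by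
    have h₁ := (I.query_supported i hi).mono (h.bag_mono i)
    rcases h.query_cases with ⟨hq, -⟩ | ⟨hn, -⟩
    · rwa [hq]
    · exact hn.supported R hi ((I'.bag_issued i hi).trans hG) h₁
  have hbc : ∀ d, o₂ = broadcast (c'.state i).query (c'.state i).bag →
      (⟨i, d, requestMsg (c'.state i).query (c'.state i).bag⟩ : Envelope n (Datum n X)) ∈
        c'.sent := by
    intro d ho
    refine h.mem_sent.2 (.inr ⟨rfl, List.mem_append_right _ ?_⟩)
    rw [ho]
    exact mem_broadcast.2 rfl
  constructor
  · intro s hs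
    by_cases hsi : s = i
    · rwa [hsi]
    · rw [h.state_ne s hsi]
      exact I.query_supported s hs
  · intro s hs d
    have hold : (c'.state s).query = (c.state s).query → ∃ e ∈ c'.sent, e.src = s ∧ e.dst = d ∧
        asked e.msg = some (Local.query (c'.state s)) := by
      intro hq
      obtain ⟨e, he, h₁, h₂, h₃⟩ := I.current s hs d
      exact ⟨e, hsent he, h₁, h₂, by rw [hq, h₃]⟩
    by_cases hsi : s = i
    · subst hsi
      rcases h.query_cases with ⟨hq, -⟩ | ⟨-, ho⟩
      · exact hold hq
      · exact ⟨_, hbc d ho, rfl, rfl, rfl⟩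
    · exact hold (by rw [h.state_ne s hsi])
  · intro e he r hr
    rcases h.asked_cases he hr with he' | ⟨rfl, rfl, -⟩
    · exact I.asked_supported e he' r hr
    · rcases h.mem_sent.1 he with he' | ⟨-, he'⟩
      · exact I.asked_supported e he' _ hr
      · have := h.out_sigs he'
        simp only at this
        rwa [this]
  · intro e he r hr
    rcases h.asked_cases he hr with he' | ⟨rfl, rfl, -⟩
    · rcases I.asked_slot e he' r hr with h₁ | rfl
      · rcases h.slot_query e.src with h₂ | h₂
        · exact .inl (h₁.trans h₂)
        · exact .inl (by rwa [← h₂])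
      · exact h.slot_query e.src
    · exact .inr rfl
  -- Slots strictly increase along the queries of a process, so a new query never shares its slot
  -- with an old one.
  · have hmixed : ∀ e ∈ c.sent, ∀ r, asked e.msg = some r → e.src = i →
        Next f i (c'.state i).bag.sigs (c.state i).query (c'.state i).query →
        slot n f r < slot n f (c'.state i).query := by
      rintro e he r hr rfl hn
      rcases I.asked_slot e he r hr with h₁ | rfl
      · exact h₁.trans hn.slot_lt
      · exact hn.slot_lt
    intro e he e' he' r r' hsrc hr hr' hslot
    rcases h.asked_cases he hr with h₁ | ⟨h₁, rfl, hn⟩ <;>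
    rcases h.asked_cases he' hr' with h₂ | ⟨h₂, rfl, hn'⟩
    · exact I.asked_unique e h₁ e' h₂ r r' hsrc hr hr' hslot
    · exact absurd hslot (hmixed e h₁ r hr (hsrc.trans h₂) hn').ne
    · exact absurd hslot.symm (hmixed e' h₂ r' hr' (hsrc.symm.trans h₁) hn).ne
    · rfl
  · intro s hs hq d
    by_cases hq' : (c.state s).query = .certify
    · by_cases hsi : s = i
      · subst hsi
        rcases h.query_cases with ⟨hq₁, -⟩ | ⟨hn, ho⟩
        · exact absurd (hq₁.trans hq') hq
        · refine ⟨_, hbc d ho, rfl, rfl, ?_⟩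
          simp only [sigs_requestMsg]
          rw [hq'] at hn
          -- From `certify` one can proceed to `publish` only, and its support is the required
          -- certificate.
          cases hn' : (c'.state s).query <;> rw [hn'] at hn hsupp <;> cases hn
          exact hsupp
      · rw [h.state_ne s hsi] at hq
        exact absurd hq' hq
    · obtain ⟨e, he, h₁⟩ := I.published s hs hq' d
      exact ⟨e, hsent he, h₁⟩

/-- The answers that correct processes have given. -/
structure AnswerInvariant (F : Finset (Fin n)) (x : Fin n → X)
    (c : Config (protocol n f X)) : Prop where
  answered : ∀ s ∉ F, ∀ j ∉ F, ∀ p, (j, p) ∈ (c.state s).answered → ∃ r, slot n f r = p ∧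
    (∃ e ∈ c.sent, e.src = j ∧ asked e.msg = some r) ∧
    ∃ e ∈ c.sent, e.src = s ∧ e.dst = j ∧ Acked f x s j e.msg.sigs r
  delivered_sent : ∀ id ∈ c.delivered, id < c.sent.length
  delivered_sigs : ∀ id ∈ c.delivered, ∀ e, c.sent[id]? = some e →
    e.msg.sigs ⊆ (c.state e.dst).bag.sigs
  delivered_answered : ∀ id ∈ c.delivered, ∀ e, c.sent[id]? = some e → ∀ r,
    asked e.msg = some r → Answerable f r → (e.src, slot n f r) ∈ (c.state e.dst).answered

theorem answerInvariant_initial (F : Finset (Fin n)) (x : Fin n → X) :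
    AnswerInvariant F x (Config.initial (protocol n f X) F x) where
  answered s _ j _ p h := by simp [Config.initial, initial] at h
  delivered_sent id h := h.elim
  delivered_sigs id h := h.elim
  delivered_answered id h := h.elim

theorem Receives.answered_subset {i j : Fin n} {m : Msg n (Datum n X)} {st₁ : Local n X}
    {o₁ o₂ : List (Fin n × Msg n (Datum n X))} (h : Receives c c' i j m st₁ o₁ o₂) (s : Fin n) :
    (c.state s).answered ⊆ (c'.state s).answered := by
  by_cases hs : s = i
  · subst hs
    rw [h.advanced.answered_eq]
    exact h.served.answered_subset
  · rw [h.state_ne s hs]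

/-- An answer shows what has been granted. -/
theorem Grants.acked {x : Fin n → X} {s j : Fin n} (hs : s ∉ F) (hj : j ∉ F)
    (I : SigInvariant F x c) {m : Msg n (Datum n X)} (hm : m.sigs ⊆ issued F c) {r : Query n X}
    {φ : Datum n X} (g : Grants f s ((c.state s).bag.pair m).sigs j r φ) {K : Sigs n X}
    (hK : ((c.state s).bag.pair m).sigs ⊆ K) (hφ : (s, Msg.data φ) ∈ K) :
    Acked f x s j K r := by
  have hpair : ((c.state s).bag.pair m).sigs ⊆ issued F c :=
    Set.union_subset (I.bag_issued s hs) hm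
  cases g with
  | certify y mem =>
    obtain rfl := I.input_eq j hj y ((hpair mem).resolve_left hj)
    exact hφ
  | write => exact hφ
  | read ℓ q V S lt quorum mem_iff =>
    refine ⟨S, hφ, fun W hW => ?_⟩
    have := I.wrote_valid s hs ℓ q W ((hpair ((mem_iff W).1 hW)).resolve_left hs)
    exact this.mono (Set.subset_union_left.trans hK)

theorem AnswerInvariant.step {x : Fin n → X} (A : AnswerInvariant F x c)
    (I : SigInvariant F x c) (Q : RequestInvariant F x c) (hstep : Step F c c') :
    AnswerInvariant F x c' := by
  rcases step_cases hstep with rfl | ⟨i, j, m, st₁, o₁, o₂, hi, h, hsrc⟩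
  · exact A
  have hm := I.msg_issued hsrc
  have hsent : ∀ {e}, e ∈ c.sent → e ∈ c'.sent := fun he => h.mem_sent.2 (.inl he)
  have hget : ∀ {id e}, id < c.sent.length → c'.sent[id]? = some e → c.sent[id]? = some e := by
    intro id e hid he
    rwa [h.sent, List.getElem?_append_left hid] at he
  have hdel : ∀ id ∈ c'.delivered, id ∈ c.delivered ∨ c.sent[id]? = some ⟨j, i, m⟩ := by
    intro id hid
    rcases hsrc with ⟨id', h₁, h₂⟩ | ⟨-, h₂, -⟩
    · rw [h₂] at hid
      rcases hid with rfl | hid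
      · exact .inr h₁
      · exact .inl hid
    · rw [h₂] at hid
      exact .inl hid
  have hlt : ∀ {id}, c.sent[id]? = some ⟨j, i, m⟩ → id < c.sent.length := fun h =>
    (List.getElem?_eq_some_iff.1 h).1
  constructor
  · intro s hs k hk p hp
    have hold : (k, p) ∈ (c.state s).answered → ∃ r, slot n f r = p ∧
        (∃ e ∈ c'.sent, e.src = k ∧ asked e.msg = some r) ∧
        ∃ e ∈ c'.sent, e.src = s ∧ e.dst = k ∧ Acked f x s k e.msg.sigs r := by
      intro hp
      obtain ⟨r, hr, ⟨e, he, h₁⟩, ⟨e', he', h₂⟩⟩ := A.answered s hs k hk p hp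
      exact ⟨r, hr, ⟨e, hsent he, h₁⟩, ⟨e', hsent he', h₂⟩⟩
    by_cases hsi : s = i
    · subst hsi
      rw [h.advanced.answered_eq] at hp
      have hmem := @h.mem_sent
      cases h.served with
      | silent => exact hold hp
      | reply r φ ask fresh grants =>
        rcases Finset.mem_insert.1 hp with hp | hp
        · obtain ⟨rfl, rfl⟩ : k = j ∧ p = slot n f r := by simpa using hp
          rcases hsrc with ⟨id, hid, -⟩ | ⟨hkF, -⟩
          · refine ⟨r, rfl, ⟨_, hsent (List.mem_of_getElem? hid), rfl, ask⟩,
              ⟨s, k, _⟩, hmem.2 (.inr ⟨rfl, List.mem_append_left _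
                (List.mem_singleton.2 rfl)⟩), rfl, rfl, ?_⟩
            refine grants.acked hs hk I hm Set.subset_union_right (.inl ?_)
            rw [sigs_sign_data]
            rfl
          · exact absurd hkF hk
        · exact hold hp
    · rw [h.state_ne s hsi] at hp
      exact hold hp
  · intro id hid
    have : id < c.sent.length := (hdel id hid).elim (A.delivered_sent id) hlt
    rw [h.sent, List.length_append]
    omega
  · intro id hid e he
    rcases hdel id hid with hid | hid
    · exact (A.delivered_sigs id hid e (hget (A.delivered_sent id hid) he)).trans (h.bag_mono _)
    · obtain rfl := Option.some.inj (hid.symm.trans (hget (hlt hid) he))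
      exact Set.subset_union_right.trans h.pair_sigs_subset
  · intro id hid e he r hr ha
    rcases hdel id hid with hid | hid
    · exact h.answered_subset _
        (A.delivered_answered id hid e (hget (A.delivered_sent id hid) he) r hr ha)
    · obtain rfl := Option.some.inj (hid.symm.trans (hget (hlt hid) he))
      have hsupp := Q.asked_supported _ (List.mem_of_getElem? hid) r hr
      have hsupp' : Supported f x j ((Local.bag (c.state i)).pair m).sigs r :=
        hsupp.mono Set.subset_union_right
      simp only at hr ⊢
      rw [h.advanced.answered_eq]
      cases h.served with
      -- The request is justified by its own signatures, so silence is possible only if this slot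
      -- was answered before.
      | silent hn =>
        by_contra hans
        obtain ⟨φ, g⟩ := hsupp'.exists_grants (s := i) ha
        exact hn r φ hr hans g
      | reply r' φ ask =>
        obtain rfl := Option.some.inj (hr.symm.trans ask)
        exact Finset.mem_insert_self _ _

end Requests

section Liveness

variable {n f : ℕ} {X : Type u} [SemilatticeSup X] {F : Finset (Fin n)} {x : Fin n → X}

/-! ### Messages -/

/-- A bound for the number of messages sent by process `i`. -/
def budget (c : Config (protocol n f X)) (i : Fin n) : ℕ :=
  n * (slot n f (Local.query (c.state i)) + 1) + (Local.answered (c.state i)).card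

/-- A reply adds a pair to `answered`; a broadcast of `n` messages raises the slot by at least one.
-/
theorem Receives.length_add_budget_le {c c' : Config (protocol n f X)} {i j : Fin n}
    {m : Msg n (Datum n X)} {st₁ : Local n X} {o₁ o₂ : List (Fin n × Msg n (Datum n X))}
    (h : Receives c c' i j m st₁ o₁ o₂) : (o₁ ++ o₂).length + budget c i ≤ budget c' i := by
  have h₁ : o₁.length + (c.state i).answered.card ≤ (c'.state i).answered.card := by
    rw [h.advanced.answered_eq]
    cases h.served with
    | silent => simp
    | reply r φ ask fresh =>
      rw [Finset.card_insert_of_notMem fresh, List.length_singleton]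
      omega
  have h₂ : o₂.length + n * (slot n f (c.state i).query + 1) ≤
      n * (slot n f (c'.state i).query + 1) := by
    rcases h.query_cases with ⟨hq, rfl, -⟩ | ⟨hn, rfl⟩
    · rw [hq]
      simp
    · have := Nat.mul_le_mul_left n (Nat.succ_le_succ hn.slot_lt)
      simp only [broadcast, List.length_map, List.length_finRange]
      calc _ = n * (slot n f (c.state i).query + 1 + 1) := by ring
        _ ≤ _ := this
  rw [List.length_append, budget, budget]
  omega

theorem length_sent_le_sum_budget (E : Execution (protocol n f X) F x) (k : ℕ) :
    (E.conf k).sent.length ≤ ∑ i ∈ Fᶜ, budget (E.conf k) i := by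
  induction k with
  | zero =>
    rw [E.conf_zero]
    have h₁ : ((List.finRange n).filter fun i => i ∉ F).length = Fᶜ.card := by
      rw [← List.toFinset_card_of_nodup ((List.nodup_finRange n).filter _)]
      congr 1
      ext i
      simp
    have h₂ : ∀ i : Fin n, budget (Config.initial (protocol n f X) F x) i = n := by
      intro i
      simp [budget, Config.initial, initial, slot]
    rw [Finset.sum_congr rfl fun i _ => h₂ i]
    simp [Config.initial, List.length_flatMap, envelopes, broadcast] at h₁ ⊢
    rw [h₁]
  | succ k ih =>
    rcases step_cases (E.step k) with hc | ⟨i, j, m, st₁, o₁, o₂, hi, h, -⟩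
    · rwa [hc]
    · have hi' : i ∈ Fᶜ := Finset.mem_compl.2 hi
      have h₁ := h.length_add_budget_le
      have h₂ : ∀ s ∈ Fᶜ.erase i, budget (E.conf (k + 1)) s = budget (E.conf k) s := by
        intro s hs
        rw [budget, budget, h.state_ne s (Finset.ne_of_mem_erase hs)]
      rw [← Finset.add_sum_erase _ _ hi'] at ih ⊢
      have h₃ : ∑ s ∈ Fᶜ.erase i, budget (E.conf (k + 1)) s =
          ∑ s ∈ Fᶜ.erase i, budget (E.conf k) s := Finset.sum_congr rfl h₂
      rw [h.sent, List.length_append, envelopes, List.length_map]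
      omega

/-- Requests of faulty processes are covered as well: nothing is granted on the last level, and each
pair of asker and slot is used once. -/
theorem answered_subset (E : Execution (protocol n f X) F x) (k : ℕ) (i : Fin n) :
    (Local.answered ((E.conf k).state i)) ⊆
      Finset.univ ×ˢ Finset.range (4 * depth f + 2) := by
  induction k with
  | zero =>
    rw [E.conf_zero]
    exact Finset.empty_subset _
  | succ k ih =>
    rcases step_cases (E.step k) with hc | ⟨s, j, m, st₁, o₁, o₂, -, h, -⟩
    · rwa [hc]
    · by_cases hs : i = s
      · subst hs
        rw [h.advanced.answered_eq]
        cases h.served with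
        | silent => exact ih
        | reply r φ ask fresh grants =>
          refine Finset.insert_subset ?_ ih
          simpa using grants.slot_lt
      · rwa [h.state_ne i hs]

/-! ### Progress -/

section Invariants

variable (hf : 3 * f < n) (hF : F.card ≤ f) (E : Execution (protocol n f X) F x)

include hf hF

theorem requestInvariant (k : ℕ) : RequestInvariant F x (E.conf k) := by
  induction k with
  | zero =>
    rw [E.conf_zero]
    exact requestInvariant_initial F x
  | succ k ih =>
    exact ih.step (run E hf hF) (sigInvariant E (k + 1))
      (subset_total (fun k => issued F (E.conf k)) (k + 1)) (E.step k)

theorem answerInvariant (k : ℕ) : AnswerInvariant F x (E.conf k) := by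
  induction k with
  | zero =>
    rw [E.conf_zero]
    exact answerInvariant_initial F x
  | succ k ih => exact ih.step (sigInvariant E k) (requestInvariant hf hF E k) (E.step k)

theorem length_sent_le (k : ℕ) : (E.conf k).sent.length ≤ 15 * n ^ 2 * (Nat.log 2 f + 1) := by
  have h : ∀ i ∈ Fᶜ, budget (E.conf k) i ≤ 15 * n * (Nat.log 2 f + 1) := by
    intro i hi
    have h₁ := ((requestInvariant hf hF E k).query_supported i
      (Finset.mem_compl.1 hi)).slot_le
    have h₂ := Finset.card_le_card (answered_subset E k i)
    rw [Finset.card_product, Finset.card_univ, Fintype.card_fin, Finset.card_range] at h₂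
    have h₃ := Nat.mul_le_mul_left n (Nat.succ_le_succ h₁)
    -- The sum is `n * (8 * depth f + 7)`, and `depth f = Nat.log 2 f + 1`; the constant 15 is
    -- attained when the logarithm is 0.
    calc budget (E.conf k) i ≤ n * (4 * depth f + 4 + 1) + n * (4 * depth f + 2) :=
          Nat.add_le_add h₃ h₂
      _ ≤ n * (15 * (Nat.log 2 f + 1)) := by
          rw [← Nat.mul_add]
          refine Nat.mul_le_mul_left n ?_
          unfold depth
          omega
      _ = _ := by ring
  calc _ ≤ ∑ i ∈ Fᶜ, budget (E.conf k) i := length_sent_le_sum_budget E k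
    _ ≤ Fᶜ.card * (15 * n * (Nat.log 2 f + 1)) := by
        simpa using Finset.sum_le_card_nsmul _ _ _ h
    _ ≤ n * (15 * n * (Nat.log 2 f + 1)) :=
        Nat.mul_le_mul_right _ ((Finset.card_le_univ _).trans_eq (Fintype.card_fin n))
    _ = _ := by ring

end Invariants

theorem sent_prefix (E : Execution (protocol n f X) F x) {k k' : ℕ} (h : k ≤ k') :
    (E.conf k).sent <+: (E.conf k').sent := by
  induction h with
  | refl => exact List.prefix_refl _
  | step _ ih =>
    refine ih.trans ?_
    rcases step_cases (E.step _) with hc | ⟨s, j, m, st₁, o₁, o₂, -, h, -⟩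
    · rw [hc]
    · rw [h.sent]
      exact List.prefix_append _ _

theorem delivered_mono (E : Execution (protocol n f X) F x) :
    Monotone fun k => (E.conf k).delivered :=
  monotone_of_step E (fun c => c.delivered) fun c c' h => by
    rcases step_cases h with rfl | ⟨i, j, m, st₁, o₁, o₂, -, -, ⟨id, -, h⟩ | ⟨-, h, -⟩⟩
    · exact le_rfl
    · rw [h]
      exact Set.subset_insert _ _
    · exact h.ge

theorem slot_query_mono (E : Execution (protocol n f X) F x) (i : Fin n) {k k' : ℕ}
    (h : k ≤ k') : slot n f (Local.query ((E.conf k).state i)) <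
      slot n f (Local.query ((E.conf k').state i)) ∨
      Local.query ((E.conf k).state i) = Local.query ((E.conf k').state i) := by
  induction h with
  | refl => exact .inr rfl
  | step _ ih =>
    have h' : ∀ c c' : Config (protocol n f X), Step F c c' →
        slot n f (c.state i).query < slot n f (c'.state i).query ∨
          (c.state i).query = (c'.state i).query := by
      intro c c' hs
      rcases step_cases hs with rfl | ⟨s, j, m, st₁, o₁, o₂, -, h, -⟩
      · exact .inr rfl
      · exact h.slot_query i
    rcases ih with ih | ih <;> rcases h' _ _ (E.step _) with h | h
    · exact .inl (ih.trans h)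
    · exact .inl (by rwa [← h])
    · exact .inl (by rwa [ih])
    · exact .inr (ih.trans h)

/-! ### Time bounds for progress -/

section Timing

variable {E : Execution (protocol n f X) F x} {τ : ℕ → ℝ}

theorem exists_delivered (T : E.IsRoundTiming τ) {k id : ℕ} {e : Envelope n (Datum n X)}
    (he : (E.conf k).sent[id]? = some e) (hdst : e.dst ∉ F) :
    ∃ k', k ≤ k' ∧ τ k' ≤ τ k + 1 ∧ id ∈ (E.conf k').delivered := by
  classical
  have hex := E.reliable k id e he hdst
  have hmin := Nat.find_spec hex
  obtain ⟨a, ha⟩ : ∃ a, Nat.find hex = a + 1 := by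
    refine Nat.exists_eq_succ_of_ne_zero fun h => ?_
    rw [h, E.conf_zero] at hmin
    exact hmin
  -- The timing bounds the event that follows a configuration in which the message is pending, here
  -- the last one before its delivery.
  have h₁ := T.delay k id e he hdst a (Nat.find_min hex (by omega))
  rw [ha] at hmin
  rcases le_total k (a + 1) with h | h
  · exact ⟨a + 1, h, h₁, hmin⟩
  · exact ⟨k, le_rfl, by linarith, delivered_mono E h hmin⟩

theorem exists_received (hf : 3 * f < n) (hF : F.card ≤ f) (T : E.IsRoundTiming τ) {k : ℕ}
    {e : Envelope n (Datum n X)} (he : e ∈ (E.conf k).sent) (hdst : e.dst ∉ F) :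
    ∃ k', k ≤ k' ∧ τ k' ≤ τ k + 1 ∧
      e.msg.sigs ⊆ (Local.bag ((E.conf k').state e.dst)).sigs ∧
      ∀ r, asked e.msg = some r → Answerable f r →
        (e.src, slot n f r) ∈ (Local.answered ((E.conf k').state e.dst)) := by
  obtain ⟨id, hid⟩ := List.mem_iff_getElem?.1 he
  obtain ⟨k', hk, hτ, hdel⟩ := exists_delivered T hid hdst
  have hid' : (E.conf k').sent[id]? = some e := by
    obtain ⟨l, hl⟩ := sent_prefix E hk
    rw [← hl, List.getElem?_append_left (List.getElem?_eq_some_iff.1 hid).1, hid]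
  have A := answerInvariant hf hF E k'
  exact ⟨k', hk, hτ, A.delivered_sigs id hdel e hid', A.delivered_answered id hdel e hid'⟩

/-- A process whose current query is new proceeds as soon as it has received its own request and
knows enough. -/
theorem exists_slot_lt (hf : 3 * f < n) (hF : F.card ≤ f) (T : E.IsRoundTiming τ) {i : Fin n}
    (hi : i ∉ F) {k k₁ : ℕ}
    (hnew : ∀ k' < k, slot n f (Local.query ((E.conf k').state i)) <
      slot n f (Local.query ((E.conf k).state i)))
    {r : Query n X} (hr : Next f i (Local.bag ((E.conf k₁).state i)).sigs
      (Local.query ((E.conf k).state i)) r) :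
    ∃ k', τ k' ≤ max (τ k₁) (τ k + 1) ∧
      slot n f (Local.query ((E.conf k).state i)) <
        slot n f (Local.query ((E.conf k').state i)) := by
  classical
  obtain ⟨e, he, hsrc, hdst, hask⟩ := (requestInvariant hf hF E k).current i hi i
  obtain ⟨id, hid⟩ := List.mem_iff_getElem?.1 he
  -- The query is new in configuration `k`, so its request was sent no earlier than in the event
  -- leading there and cannot be delivered yet.
  have hundel : id ∉ (E.conf k).delivered := by
    intro hdel
    rcases Nat.eq_zero_or_pos k with rfl | hpos
    · rw [E.conf_zero] at hdel
      exact hdel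
    · obtain ⟨k₀, rfl⟩ := Nat.exists_eq_succ_of_ne_zero hpos.ne'
      have hmem : e ∈ (E.conf k₀).sent := by
        have hlt : id < (E.conf k₀).sent.length := by
          rcases step_cases (E.step k₀) with hc | ⟨s, j, m, st₁, o₁, o₂, -, h, hd⟩
          · rw [hc] at hdel
            exact (answerInvariant hf hF E k₀).delivered_sent id hdel
          · rcases hd with ⟨id', h₁, h₂⟩ | ⟨-, h₂, -⟩
            · rw [h₂] at hdel
              rcases hdel with rfl | hdel
              · exact (List.getElem?_eq_some_iff.1 h₁).1
              · exact (answerInvariant hf hF E k₀).delivered_sent id hdel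
            · rw [h₂] at hdel
              exact (answerInvariant hf hF E k₀).delivered_sent id hdel
        obtain ⟨l, hl⟩ := sent_prefix E (Nat.le_succ k₀)
        rw [← hl, List.getElem?_append_left hlt] at hid
        exact List.mem_of_getElem? hid
      have h₁ := (requestInvariant hf hF E k₀).asked_slot e hmem _ hask
      rw [hsrc] at h₁
      have h₂ := hnew k₀ (Nat.lt_succ_self _)
      rcases h₁ with h₁ | h₁
      · omega
      · rw [h₁] at h₂
        exact lt_irrefl _ h₂
  obtain ⟨k₃, hk₃, hτ₃, hdel⟩ := exists_delivered T hid (by rwa [hdst])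
  -- A process advances by at most one query per received message, so knowing enough is not a
  -- trigger. The delivery of the own request provides one: in the first configuration where it has
  -- arrived and the next query is justified, process `i` has just reacted.
  have hex : ∃ a, id ∈ (E.conf a).delivered ∧
      Next f i (Local.bag ((E.conf a).state i)).sigs (Local.query ((E.conf k).state i)) r :=
    ⟨max k₁ k₃, delivered_mono E (le_max_right _ _) hdel,
      hr.mono (bag_mono E i (le_max_left _ _))⟩
  have hle : Nat.find hex ≤ max k₁ k₃ :=
    Nat.find_min' hex ⟨delivered_mono E (le_max_right _ _) hdel,
      hr.mono (bag_mono E i (le_max_left _ _))⟩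
  obtain ⟨hfdel, hfnext⟩ := Nat.find_spec hex
  have hkf : k < Nat.find hex := by
    by_contra! h
    exact hundel (delivered_mono E h hfdel)
  obtain ⟨a, ha⟩ := Nat.exists_eq_succ_of_ne_zero (Nat.ne_zero_of_lt hkf)
  have hmin := Nat.find_min hex (show a < Nat.find hex by omega)
  rw [ha] at hle hfdel hfnext hkf
  refine ⟨a + 1, ?_, ?_⟩
  · have h₁ := T.mono hle
    rcases le_total k₁ k₃ with h | h
    · rw [max_eq_right h] at h₁
      exact le_max_of_le_right (h₁.trans hτ₃)
    · rw [max_eq_left h] at h₁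
      exact le_max_of_le_left h₁
  rcases slot_query_mono E i hkf.le with h | hq
  · exact h
  exfalso
  rcases step_cases (E.step a) with hc | ⟨s, j, m, st₁, o₁, o₂, -, h, hd⟩
  · rw [Nat.succ_eq_add_one, hc] at hfdel hfnext
    exact hmin ⟨hfdel, hfnext⟩
  · have hsi : s = i := by
      by_contra hsi
      rw [Nat.succ_eq_add_one] at hfdel hfnext
      rw [h.state_ne i (Ne.symm hsi)] at hfnext
      have hdel' : id ∉ (E.conf a).delivered := fun h => hmin ⟨h, hfnext⟩
      rcases hd with ⟨id', h₁, h₂⟩ | ⟨-, h₂, -⟩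
      · rw [h₂] at hfdel
        rcases hfdel with rfl | hfdel
        · obtain ⟨l, hl⟩ := sent_prefix E (show k ≤ a by omega)
          have h₃ : (E.conf a).sent[id]? = some e := by
            rw [← hl, List.getElem?_append_left (List.getElem?_eq_some_iff.1 hid).1, hid]
          rw [h₁] at h₃
          obtain rfl := Option.some.inj h₃
          exact hsi hdst
        · exact hdel' hfdel
      · rw [h₂] at hfdel
        exact hdel' hfdel
    subst hsi
    -- If `i` stayed, no next query was justified, against `hfnext`; if it advanced, its slot rose,
    -- against `hq`.
    rcases h.query_cases with ⟨-, -, hn⟩ | ⟨hn, -⟩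
    · refine hn r ?_
      rw [← hq]
      exact hfnext
    · have h₁ := hn.slot_lt
      have h₂ := slot_query_mono E s (show k ≤ a by omega)
      rw [Nat.succ_eq_add_one] at hq
      rw [hq] at h₂
      rcases h₂ with h₂ | h₂
      · omega
      · rw [h₂] at h₁
        exact lt_irrefl _ h₁

/-- Every correct process answers in time. -/
theorem exists_acked (hf : 3 * f < n) (hF : F.card ≤ f) (T : E.IsRoundTiming τ) {i s : Fin n}
    (hi : i ∉ F) (hs : s ∉ F) {k : ℕ}
    (ha : Answerable f (Local.query ((E.conf k).state i))) :
    ∃ k', τ k' ≤ τ k + 2 ∧ Acked f x s i (Local.bag ((E.conf k').state i)).sigs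
      (Local.query ((E.conf k).state i)) := by
  obtain ⟨e, he, hsrc, rfl, hask⟩ := (requestInvariant hf hF E k).current i hi s
  obtain ⟨k₁, hk₁, hτ₁, -, hans⟩ := exists_received hf hF T he hs
  have h₁ := hans _ hask ha
  rw [hsrc] at h₁
  obtain ⟨r, hr, ⟨e₁, he₁, hsrc₁, hask₁⟩, ⟨e₂, he₂, -, rfl, hack⟩⟩ :=
    (answerInvariant hf hF E k₁).answered _ hs i hi _ h₁
  -- Only the slot of the answered query is recorded; as a correct process asks one query per slot,
  -- it is the current one.
  obtain rfl : r = Local.query ((E.conf k).state e₂.dst) :=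
    (requestInvariant hf hF E k₁).asked_unique e₁ he₁ e ((sent_prefix E hk₁).subset he) _ _
      (hsrc₁.trans hsrc.symm) hask₁ hask hr
  obtain ⟨k₂, -, hτ₂, hsub, -⟩ := exists_received hf hF T he₂ hi
  exact ⟨k₂, by linarith, hack.mono hsub⟩

theorem card_compl_ge (hF : F.card ≤ f) : n - f ≤ Fᶜ.card := by
  rw [Finset.card_compl, Fintype.card_fin]
  omega

/-- When all correct processes have answered, the next query is determined. -/
theorem exists_next {n f : ℕ} {X : Type u} {F : Finset (Fin n)} {x : Fin n → X}
    (hF : F.card ≤ f) {i : Fin n} {K : Sigs n X} {r : Query n X}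
    (ha : Answerable f r) (h : ∀ s ∉ F, Acked f x s i K r) : ∃ r', Next f i K r r' := by
  have hmem : ∀ {s}, s ∈ Fᶜ → s ∉ F := fun hs => Finset.mem_compl.1 hs
  cases r with
  | certify => exact ⟨_, .publish (x i) ⟨Fᶜ, card_compl_ge hF, fun s hs => h s (hmem hs)⟩⟩
  | publish => exact ha.elim
  | write ℓ q V => exact ⟨_, .read ℓ q V ha ⟨Fᶜ, card_compl_ge hF, fun s hs => h s (hmem hs)⟩⟩
  | read ℓ q V =>
    have h' : ∀ s, ∃ S : Finset (Value n X), s ∈ Fᶜ → (s, Msg.data (.saw ℓ q V S)) ∈ K ∧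
        ∀ W ∈ S, Valid f K ℓ q W := by
      intro s
      by_cases hs : s ∈ F
      · exact ⟨∅, fun h => absurd hs (hmem h)⟩
      · obtain ⟨S, hS⟩ := h s hs
        exact ⟨S, fun _ => hS⟩
    choose S hS using h'
    have hr : Reads f K ℓ q V (gather Fᶜ S) :=
      ⟨Fᶜ, S, ⟨card_compl_ge hF, fun s hs => (hS s hs).1⟩, fun s hs => (hS s hs).2, rfl⟩
    by_cases h₁ : middle n f ℓ q ≤ V.card
    · exact ⟨_, .high ℓ q V _ ha hr h₁⟩
    · by_cases h₂ : (gather Fᶜ S).card < middle n f ℓ q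
      · exact ⟨_, .low ℓ q V _ ha hr h₂⟩
      · exact ⟨_, .join ℓ q V _ ha hr (not_le.1 h₁) (not_lt.1 h₂)⟩

/-- A common time for conditions on all correct processes. -/
theorem exists_forall_correct {n : ℕ} {F : Finset (Fin n)} {τ : ℕ → ℝ} {i : Fin n} (hi : i ∉ F)
    {t : ℝ}
    {P : Fin n → ℕ → Prop} (hP : ∀ s, ∀ k k', k ≤ k' → P s k → P s k')
    (h : ∀ s ∉ F, ∃ k, τ k ≤ t ∧ P s k) : ∃ k, τ k ≤ t ∧ ∀ s ∉ F, P s k := by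
  have h' : ∀ s, ∃ k, s ∈ Fᶜ → τ k ≤ t ∧ P s k := by
    intro s
    by_cases hs : s ∈ F
    · exact ⟨0, fun h => absurd hs (Finset.mem_compl.1 h)⟩
    · obtain ⟨k, hk⟩ := h s hs
      exact ⟨k, fun _ => hk⟩
  choose κ hκ using h'
  obtain ⟨s₀, hs₀, hmax⟩ := Finset.exists_max_image Fᶜ κ ⟨i, Finset.mem_compl.2 hi⟩
  exact ⟨κ s₀, (hκ s₀ hs₀).1, fun s hs => hP s _ _ (hmax s (Finset.mem_compl.2 hs))
    (hκ s (Finset.mem_compl.2 hs)).2⟩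

/-- Slots may be skipped, for instance by a low value, which never uses the second pair of slots of
its level. So either `p` is passed over, or there is a first configuration in slot `p`, as
`exists_slot_lt` requires. -/
theorem exists_first {i : Fin n} (T : E.IsRoundTiming τ) {p : ℕ} {t : ℝ}
    (h : ∃ k, τ k ≤ t ∧ p ≤ slot n f (Local.query ((E.conf k).state i))) :
    (∃ k, τ k ≤ t ∧ p + 1 ≤ slot n f (Local.query ((E.conf k).state i))) ∨
    ∃ k, τ k ≤ t ∧ slot n f (Local.query ((E.conf k).state i)) = p ∧
      ∀ k' < k, slot n f (Local.query ((E.conf k').state i)) <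
        slot n f (Local.query ((E.conf k).state i)) := by
  classical
  obtain ⟨k₀, hτ, hk₀⟩ := h
  have hex : ∃ k, p ≤ slot n f (Local.query ((E.conf k).state i)) := ⟨k₀, hk₀⟩
  have hτ' := (T.mono (Nat.find_min' hex hk₀)).trans hτ
  rcases (Nat.find_spec hex).lt_or_eq with h | h
  · exact .inl ⟨_, hτ', h⟩
  · exact .inr ⟨_, hτ', h.symm, fun k' hk' => by
      have := Nat.find_min hex hk'
      omega⟩

/-- One unit of time for the request and one for the answers. -/
theorem reach_succ (hf : 3 * f < n) (hF : F.card ≤ f) (T : E.IsRoundTiming τ) {i : Fin n}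
    (hi : i ∉ F) {p : ℕ} (hp : p ≠ 1) (hp' : p < 4 * depth f + 2) {t : ℝ}
    (h : ∃ k, τ k ≤ t ∧ p ≤ slot n f (Local.query ((E.conf k).state i))) :
    ∃ k, τ k ≤ t + 2 ∧ p + 1 ≤ slot n f (Local.query ((E.conf k).state i)) := by
  rcases exists_first T h with ⟨k, hτ, hk⟩ | ⟨k, hτ, rfl, hnew⟩
  · exact ⟨k, by linarith, hk⟩
  have ha := ((requestInvariant hf hF E k).query_supported i hi).answerable hp hp'
  obtain ⟨k₁, hτ₁, hack⟩ := exists_forall_correct hi (t := τ k + 2)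
    (P := fun s k' => Acked f x s i (Local.bag ((E.conf k').state i)).sigs
      (Local.query ((E.conf k).state i)))
    (fun s k₁ k₂ h => Acked.mono (bag_mono E i h))
    (fun s hs => exists_acked hf hF T hi hs ha)
  obtain ⟨r, hr⟩ := exists_next hF ha hack
  obtain ⟨k₂, hτ₂, h₂⟩ := exists_slot_lt hf hF T hi hnew hr
  refine ⟨k₂, hτ₂.trans (max_le ?_ ?_), h₂⟩ <;> linarith

/-- `publish` gets no answers. It ends when the certificates of all correct processes have arrived,
one unit after they are sent, so the hypothesis concerns all correct processes and not only `i`. -/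
theorem reach_two (hf : 3 * f < n) (hF : F.card ≤ f) (T : E.IsRoundTiming τ) {t : ℝ}
    (h : ∀ i ∉ F, ∃ k, τ k ≤ t ∧ 1 ≤ slot n f (Local.query ((E.conf k).state i)))
    {i : Fin n} (hi : i ∉ F) :
    ∃ k, τ k ≤ t + 1 ∧ 2 ≤ slot n f (Local.query ((E.conf k).state i)) := by
  rcases exists_first T (h i hi) with ⟨k, hτ, hk⟩ | ⟨k, hτ, hslot, hnew⟩
  · exact ⟨k, by linarith, hk⟩
  obtain ⟨k₁, hτ₁, hcert⟩ := exists_forall_correct hi (t := t + 1)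
    (P := fun s k' => Quorum f (Local.bag ((E.conf k').state i)).sigs (.certified s (x s)))
    (fun s k₁ k₂ h => Quorum.mono (bag_mono E i h))
    (fun s hs => by
      obtain ⟨k', hτ', hk'⟩ := h s hs
      obtain ⟨e, he, -, rfl, hq⟩ := (requestInvariant hf hF E k').published s hs
        (fun h => by rw [h] at hk'; simp [slot] at hk') i
      obtain ⟨k₂, -, hτ₂, hsub, -⟩ := exists_received hf hF T he hi
      exact ⟨k₂, by linarith, hq.mono hsub⟩)
  have hq : Local.query ((E.conf k).state i) = .publish := by
    cases hq : Local.query ((E.conf k).state i) <;> rw [hq] at hslot <;>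
      first | rfl | (simp [slot] at hslot; done) | (simp only [slot] at hslot; omega)
  -- The inputs of all correct processes form a possible first value: there are at least `n - f` of
  -- them, all certified by now.
  have hr : Next f i (Local.bag ((E.conf k₁).state i)).sigs
      (Local.query ((E.conf k).state i))
      (.write 0 0 (Fᶜ.map ⟨fun s => (s, x s), fun s s' h => congrArg Prod.fst h⟩)) := by
    rw [hq]
    refine .start _ (x i) (fun e he => ?_) (by simpa using card_compl_ge hF) 
      (Finset.mem_map.2 ⟨i, Finset.mem_compl.2 hi, rfl⟩)
    obtain ⟨s, hs, rfl⟩ := Finset.mem_map.1 he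
    exact hcert s (Finset.mem_compl.1 hs)
  obtain ⟨k₂, hτ₂, h₂⟩ := exists_slot_lt hf hF T hi hnew hr
  refine ⟨k₂, hτ₂.trans (max_le ?_ ?_), by omega⟩ <;> linarith

theorem reach (hf : 3 * f < n) (hF : F.card ≤ f) (T : E.IsRoundTiming τ) {p : ℕ}
    (hp : p ≤ 4 * depth f + 2) : ∀ i ∉ F, ∃ k, τ k ≤ 2 * p ∧
      p ≤ slot n f (Local.query ((E.conf k).state i)) := by
  induction p with
  | zero => exact fun i _ => ⟨0, by simp [T.zero], Nat.zero_le _⟩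
  | succ p ih =>
    intro i hi
    have ih := ih (by omega)
    push_cast
    rcases eq_or_ne p 1 with rfl | hp₁
    · obtain ⟨k, hτ, hk⟩ := reach_two hf hF T ih hi
      exact ⟨k, by push_cast at hτ ⊢; linarith, hk⟩
    · obtain ⟨k, hτ, hk⟩ := reach_succ hf hF T hi hp₁ hp (ih i hi)
      exact ⟨k, by linarith, hk⟩

/-- Every correct process reaches the last level in time. -/
theorem exists_final (hf : 3 * f < n) (hF : F.card ≤ f) (T : E.IsRoundTiming τ) {i : Fin n}
    (hi : i ∉ F) : ∃ k, τ k ≤ 2 * (4 * depth f + 2 : ℕ) ∧ ∃ q V,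
      Local.query ((E.conf k).state i) = .write (depth f) q V := by
  obtain ⟨k, hτ, hk⟩ := reach hf hF T le_rfl i hi
  refine ⟨k, hτ, ?_⟩
  have hs := (requestInvariant hf hF E k).query_supported i hi
  cases hq : Local.query ((E.conf k).state i) with
  | certify => simp [hq, slot] at hk
  | publish => simp [hq, slot] at hk
  | write ℓ q V =>
    rw [hq] at hk hs
    have h₁ := hs.2.1
    -- Queries below the last level have slots of at most `4 * depth f + 1`.
    obtain rfl : ℓ = depth f := by
      simp only [slot] at hk
      split_ifs at hk <;> omega
    exact ⟨q, V, rfl⟩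
  | read ℓ q V =>
    rw [hq] at hk hs
    have h₁ := hs.2.1
    simp only [slot] at hk
    split_ifs at hk <;> omega

end Timing

end Liveness

section Main

variable {n f : ℕ} {X : Type u} [SemilatticeSup X] {F : Finset (Fin n)} {x : Fin n → X}

/-! ### Decisions -/

section Decisions

variable {E : Execution (protocol n f X) F x}

theorem out_of_query_eq {i : Fin n} {k q : ℕ} {V : Value n X}
    (h : Local.query ((E.conf k).state i) = .write (depth f) q V) :
    E.out k i = decision V := by
  change result f (Local.mk _ _ _) = _
  simp only [result, h, if_true]

/-- The last query is final. -/
theorem query_eq_of_le {i : Fin n} {k k' q : ℕ} {V : Value n X}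
    (h : Local.query ((E.conf k).state i) = .write (depth f) q V) (hk : k ≤ k') :
    Local.query ((E.conf k').state i) = .write (depth f) q V := by
  induction hk with
  | refl => exact h
  | step _ ih =>
    rcases step_cases (E.step _) with hc | ⟨s, j, m, st₁, o₁, o₂, -, hr, -⟩
    · rwa [Nat.succ_eq_add_one, hc]
    · by_cases hs : i = s
      · subst hs
        rcases hr.query_cases with ⟨hq, -⟩ | ⟨hn, -⟩
        · rw [Nat.succ_eq_add_one, hq, ih]
        · rw [ih] at hn
          generalize Local.query ((E.conf (_ + 1)).state i) = r at hn
          cases hn with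
          | read _ _ _ lt => exact absurd lt (lt_irrefl _)
      · rwa [Nat.succ_eq_add_one, hr.state_ne i hs]

theorem exists_final_of_out_eq {i : Fin n} {k : ℕ} {z : X} (h : E.out k i = some z) :
    ∃ q V, Local.query ((E.conf k).state i) = .write (depth f) q V := by
  change result f ((E.conf k).state i) = some z at h
  cases hq : Local.query ((E.conf k).state i) with
  | write ℓ q V =>
    simp only [result, hq] at h
    split_ifs at h with hℓ
    exact ⟨q, V, by rw [hℓ]⟩
  | _ => simp [result, hq] at h

theorem decides_of_query_eq {i : Fin n} {k q : ℕ} {V : Value n X} {y : X}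
    (h : Local.query ((E.conf k).state i) = .write (depth f) q V) (hy : decision V = some y) :
    E.Decides i y := by
  have hu : ∀ k' z, E.out k' i = some z → z = y := by
    intro k' z hz
    obtain ⟨q', V', h'⟩ := exists_final_of_out_eq hz
    have h₁ := query_eq_of_le h (le_max_left k k')
    have h₂ := query_eq_of_le h' (le_max_right k k')
    rw [h₁] at h₂
    obtain ⟨-, -, rfl⟩ := Query.write.inj h₂
    rw [out_of_query_eq h', hy] at hz
    exact (Option.some.inj hz).symm
  refine ⟨⟨k, (out_of_query_eq h).trans hy⟩, hu, fun k₁ k₂ hk h₁ => ?_⟩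
  obtain ⟨q', V', h'⟩ := exists_final_of_out_eq h₁
  rw [out_of_query_eq (query_eq_of_le h' hk), ← out_of_query_eq h', h₁]

theorem decision_eq {V : Value n X} (h : V.Nonempty) : decision V = some (V.sup' h Prod.snd) :=
  dif_pos h

/-- Any execution can be timed, as messages may be arbitrarily fast. -/
theorem isRoundTiming_zero : E.IsRoundTiming fun _ => 0 where
  zero := rfl
  mono := monotone_const
  delay _ _ _ _ _ _ _ := by norm_num

/-- The final value of each correct process. -/
theorem exists_values (hf : 3 * f < n) (hF : F.card ≤ f) (E : Execution (protocol n f X) F x) :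
    ∃ V : Fin n → Value n X, ∀ i ∉ F, (i, x i) ∈ V i ∧
      (∃ q, Valid f (total fun k => issued F (E.conf k)) (depth f) q (V i)) ∧
      ∃ k q, Local.query ((E.conf k).state i) = .write (depth f) q (V i) := by
  have h : ∀ i, ∃ V : Value n X, i ∉ F → (i, x i) ∈ V ∧
      (∃ q, Valid f (total fun k => issued F (E.conf k)) (depth f) q V) ∧
      ∃ k q, Local.query ((E.conf k).state i) = .write (depth f) q V := by
    intro i
    by_cases hi : i ∈ F
    · exact ⟨∅, fun h => absurd hi h⟩
    -- Termination without time is the timed statement for the timing that is constantly zero.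
    obtain ⟨k, -, q, V, hq⟩ := exists_final hf hF (isRoundTiming_zero (E := E)) hi
    have hs := (requestInvariant hf hF E k).query_supported i hi
    rw [hq] at hs
    exact ⟨V, fun _ => ⟨hs.2.2, ⟨q, hs.1.mono (((sigInvariant E k).bag_issued i hi).trans
      (subset_total (fun k => issued F (E.conf k)) k))⟩, k, q, hq⟩⟩
  choose V hV using h
  exact ⟨V, hV⟩

theorem isLUB_sup' {α ι : Type*} [SemilatticeSup α] (s : Finset ι) (h : s.Nonempty) (g : ι → α) :
    IsLUB (g '' s) (s.sup' h g) := by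
  constructor
  · rintro _ ⟨a, ha, rfl⟩
    exact Finset.le_sup' g ha
  · exact fun b hb => Finset.sup'_le h g fun a ha => hb ⟨a, ha, rfl⟩

/-- Lattice agreement from a chain of sets of certified inputs. -/
theorem isBLA {G : ℕ → Sigs n X} (R : Run f F x G) {V : Fin n → Value n X} {y : Fin n → X}
    (hne : ∀ i, i ∉ F → (V i).Nonempty)
    (hy : ∀ i (hi : i ∉ F), y i = (V i).sup' (hne i hi) Prod.snd)
    (own : ∀ i ∉ F, (i, x i) ∈ V i)
    (valid : ∀ i ∉ F, ∃ q, Valid f (total G) (depth f) q (V i)) : IsBLA F x y where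
  comparability i hi j hj := by
    obtain ⟨q, hq⟩ := valid i hi
    obtain ⟨q', hq'⟩ := valid j hj
    rw [hy i hi, hy j hj]
    rcases R.comparable hq hq' with h | h
    · exact .inl (Finset.sup'_mono _ h _)
    · exact .inr (Finset.sup'_mono _ h _)
  downward_validity i hi := by
    rw [hy i hi]
    exact Finset.le_sup' Prod.snd (own i hi)
  upward_validity := by
    classical
    have hFc : Fᶜ.Nonempty := by
      rw [← Finset.card_pos, Finset.card_compl, Fintype.card_fin]
      have h₁ := R.resilient
      have h₂ := R.faulty_card
      omega
    -- `B` collects the certified inputs of faulty processes, at most one for each.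
    set C := R.finite_certifiedSet.toFinset.filter fun e => e.1 ∈ F with hC
    set B := C.image Prod.snd with hB
    have hcard : B.card ≤ F.card := by
      refine Finset.card_image_le.trans ?_
      refine Finset.card_le_card_of_injOn Prod.fst (fun e he => (Finset.mem_filter.1 he).2) ?_
      refine R.injOn_certifiedSet.mono fun e he => ?_
      simpa using (Finset.mem_filter.1 he).1
    have hxB : (Fᶜ.image x ∪ B).Nonempty := (hFc.image x).mono Finset.subset_union_left
    refine ⟨B, hcard, Fᶜ.sup' hFc y, (Fᶜ.image x ∪ B).sup' hxB id, ?_, ?_, ?_⟩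
    · convert isLUB_sup' Fᶜ hFc y using 1
      ext a
      simp
    · convert isLUB_sup' (Fᶜ.image x ∪ B) hxB id using 1
      ext a
      simp
    · refine Finset.sup'_le _ _ fun i hi => ?_
      have hi := Finset.mem_compl.1 hi
      obtain ⟨q, hq⟩ := valid i hi
      rw [hy i hi]
      refine Finset.sup'_le _ _ fun e he => Finset.le_sup' id (b := e.2) ?_
      have hcert := R.valid_certified hq e he
      by_cases heF : e.1 ∈ F
      · refine Finset.mem_union_right _ (Finset.mem_image.2 ⟨e, ?_, rfl⟩)
        exact Finset.mem_filter.2 ⟨by simpa [Run.certifiedSet] using hcert, heF⟩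
      · refine Finset.mem_union_left _ (Finset.mem_image.2 ⟨e.1, Finset.mem_compl.2 heF, ?_⟩)
        exact (R.eq_input_of_certified heF hcert).symm

end Decisions

/-- The protocol solves Byzantine lattice agreement. -/
theorem solves (hf : 3 * f < n) :
    Solves (protocol n f X) f (15 * (Nat.log 2 f + 1)) (15 * n ^ 2 * (Nat.log 2 f + 1)) where
  signsHonestly := signsHonestly n f
  agreement F hF x E := by
    obtain ⟨V, hV⟩ := exists_values hf hF E
    have hne : ∀ i, i ∉ F → (V i).Nonempty := fun i hi => ⟨_, (hV i hi).1⟩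
    classical
    refine ⟨fun i => if hi : i ∉ F then (V i).sup' (hne i hi) Prod.snd else x i, fun i hi => ?_,
      isBLA (run E hf hF) hne (fun i hi => dif_pos hi) (fun i hi => (hV i hi).1)
        (fun i hi => (hV i hi).2.1)⟩
    obtain ⟨k, q, hq⟩ := (hV i hi).2.2
    beta_reduce
    rw [dif_pos hi]
    exact decides_of_query_eq hq (decision_eq (hne i hi))
  rounds F hF x E τ T i hi := by
    obtain ⟨k, hτ, q, V, hq⟩ := exists_final hf hF T hi
    have hs := (requestInvariant hf hF E k).query_supported i hi
    rw [hq] at hs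
    refine ⟨k, hτ.trans ?_, ?_⟩
    · have h : 2 * (4 * depth f + 2) ≤ 15 * (Nat.log 2 f + 1) := by
        unfold depth
        omega
      exact_mod_cast h
    · rw [out_of_query_eq hq, decision_eq ⟨_, hs.2.2⟩]
      rfl
  messages F hF x E k := length_sent_le hf hF E k

end Main

end AuthBLA.Halving

theorem theorem2 :
    ∃ c : ℕ, ∀ (n f : ℕ), 3 * f < n → ∀ (X : Type*) [SemilatticeSup X],
      ∃ P : AuthBLA.Protocol n X,
        AuthBLA.Solves P f (c * (Nat.log 2 f + 1)) (c * n ^ 2 * (Nat.log 2 f + 1)) :=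
  ⟨15, fun n f hf X _ => ⟨AuthBLA.Halving.protocol n f X, AuthBLA.Halving.solves hf⟩⟩
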